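/- Let $M$ be a connected (Hausdorff, finite-dimensional, smooth) manifold with a smooth Riemannian metric $\alpha$, and let $\beta$ be a smooth one-form on $M$, not identically zero, whose $\alpha$-dual vector field $\beta^\sharp$ (defined by $\alpha(\beta^\sharp,Y)=\beta(Y)$) has Riemannian length less than one at every point. Let $F(v)=\sqrt{\alpha(v,v)}+\beta(v)$ be the corresponding (non-Riemannian) Randers metric. A smooth linear connection $\nabla$ on $M$ is called compatible with $F$ if its parallel transports along smooth curves preserve $F$. Assume that $F$ is a generalized Berwald metric, i.e. that a compatible linear connection exists. A compatible linear connection is called extremal if, at each point of $M$, the norm of its torsion tensor (the norm induced by $\alpha$, i.e. $|T|^2=\sum_{i,j,k}\alpha(T(e_i,e_j),e_k)^2$ for an orthonormal basis $(e_i)$) is minimal among all compatible linear connections. Then $\beta^\sharp$ has constant Riemannian length $K>0$. Let $\nabla^*$ be the Lévi-Civita connection of $\alpha$, let $$\nabla^\circ_XY=\nabla^*_XY+\frac{\alpha(\nabla^*_X\beta^\sharp,Y)}{K^2}\,\beta^\sharp-\frac{\alpha(Y,\beta^\sharp)}{K^2}\,\nabla^*_X\beta^\sharp ,$$ and let $T^\circ$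 be the torsion of $\nabla^\circ$. There is exactly one extremal compatible linear connection, and its torsion $T$ satisfies, for all smooth vector fields $X,Y,Z$ on $M$, $$\alpha(T(X,Y),Z)=\alpha(T^\circ(X,Y),Z)+\frac{\beta(Y)\,d\beta(X,Z)-\beta(X)\,d\beta(Y,Z)}{2K^2}+\frac{\beta(X)\,d\beta(Y,\beta^\sharp)-\beta(Y)\,d\beta(X,\beta^\sharp)}{2K^4}\,\beta(Z),$$ where $d\beta(X,Y)=X(\beta(Y))-Y(\beta(X))-\beta([X,Y])$. -/

import Mathlib

open Bundle
open scoped Manifold ContDiff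

noncomputable section

namespace Randers

section General

variable {E : Type*} [NormedAddCommGroup E] [NormedSpace ℝ E]
  {M : Type*} [TopologicalSpace M] [ChartedSpace E M]

/-- A vector field `X` on `M` is smooth. -/
def IsSmoothField [IsManifold 𝓘(ℝ, E) ∞ M] (X : Π x : M, TangentSpace 𝓘(ℝ, E) x) : Prop :=
  ContMDiff 𝓘(ℝ, E) (𝓘(ℝ, E).prod 𝓘(ℝ, E)) ∞
    (fun x ↦ (TotalSpace.mk' E x (X x) : TotalSpace E (fun x : M ↦ TangentSpace 𝓘(ℝ, E) x)))

/-- A one-form `β` on `M` is smooth. -/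
def IsSmoothOneForm [IsManifold 𝓘(ℝ, E) ∞ M] (β : Π x : M, TangentSpace 𝓘(ℝ, E) x →L[ℝ] ℝ) :
    Prop :=
  ContMDiff 𝓘(ℝ, E) (𝓘(ℝ, E).prod 𝓘(ℝ, E →L[ℝ] ℝ)) ∞
    (fun x ↦ (TotalSpace.mk' (E →L[ℝ] ℝ) x (β x) :
      TotalSpace (E →L[ℝ] ℝ) (fun x : M ↦ TangentSpace 𝓘(ℝ, E) x →L[ℝ] ℝ)))

/-- The exterior derivative of a one-form, evaluated on two vector fields:
`dβ(X, Y) = X(β(Y)) - Y(β(X)) - β([X, Y])`. -/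
def extDerivOneForm (β : Π x : M, TangentSpace 𝓘(ℝ, E) x →L[ℝ] ℝ)
    (X Y : Π x : M, TangentSpace 𝓘(ℝ, E) x) (x : M) : ℝ :=
  mvfderiv 𝓘(ℝ, E) (fun y ↦ β y (Y y)) x (X x) - mvfderiv 𝓘(ℝ, E) (fun y ↦ β y (X y)) x (Y x)
    - β x (VectorField.mlieBracket 𝓘(ℝ, E) X Y x)

/-- A linear connection on `M`, as a covariant derivative of vector fields.
In Mathlib's convention `D Y x (X x)` is `(∇_X Y)(x)`. -/
abbrev Connection (E : Type*) [NormedAddCommGroup E] [NormedSpace ℝ E]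
    (M : Type*) [TopologicalSpace M] [ChartedSpace E M] [IsManifold 𝓘(ℝ, E) ∞ M] :=
  CovariantDerivative 𝓘(ℝ, E) E (fun x : M ↦ TangentSpace 𝓘(ℝ, E) x)

/-- The vector field `V` along the curve `γ : [a, b] → M` is parallel with respect to the linear
connection `D`. Let `e` be the trivialization of `TM` belonging to a chart around `γ t`, let
`w s` be the coordinate vector of `V s`, and let `σ_u` be the local vector field with constant
coordinate vector `u`. The equation of parallelism `DV/dt = 0` reads
`w'(t) = -(coordinates of (∇_{γ'(t)} σ_{w(t)})(γ t))`. It does not depend on the chart. -/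
def IsParallelAlong [IsManifold 𝓘(ℝ, E) ∞ M] (D : Connection E M) (γ : ℝ → M) (a b : ℝ)
    (V : Π t : ℝ, TangentSpace 𝓘(ℝ, E) (γ t)) : Prop :=
  ∀ t ∈ Set.Icc a b, ∃ x₀ : M,
    let e := trivializationAt E (fun x : M ↦ TangentSpace 𝓘(ℝ, E) x) x₀
    let w : ℝ → E := fun s ↦ (e ⟨γ s, V s⟩).2
    γ t ∈ e.baseSet ∧
      HasDerivWithinAt w
        (-(e ⟨γ t, D (fun y ↦ e.symm y (w t)) (γ t)
          (mfderivWithin 𝓘(ℝ, ℝ) 𝓘(ℝ, E) γ (Set.Icc a b) t (1 : ℝ))⟩).2)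
        (Set.Icc a b) t

end General

section Riemannian

variable {E : Type*} [NormedAddCommGroup E] [NormedSpace ℝ E] [FiniteDimensional ℝ E]
  {M : Type*} [TopologicalSpace M] [ChartedSpace E M]
  [RiemannianBundle (fun x : M ↦ TangentSpace 𝓘(ℝ, E) x)]

instance finiteDimensional_tangentSpace (x : M) :
    FiniteDimensional ℝ (TangentSpace 𝓘(ℝ, E) x) :=
  inferInstanceAs (FiniteDimensional ℝ E)

instance completeSpace_tangentSpace (x : M) : CompleteSpace (TangentSpace 𝓘(ℝ, E) x) :=
  FiniteDimensional.complete ℝ (TangentSpace 𝓘(ℝ, E) x)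

/-- The dual vector field `β♯` of a one-form: `α(β♯, v) = β(v)`. -/
def sharp (β : Π x : M, TangentSpace 𝓘(ℝ, E) x →L[ℝ] ℝ) (x : M) : TangentSpace 𝓘(ℝ, E) x :=
  (InnerProductSpace.toDual ℝ (TangentSpace 𝓘(ℝ, E) x)).symm (β x)

lemma inner_sharp (β : Π x : M, TangentSpace 𝓘(ℝ, E) x →L[ℝ] ℝ) (x : M)
    (v : TangentSpace 𝓘(ℝ, E) x) : inner ℝ (sharp β x) v = β x v :=
  InnerProductSpace.toDual_symm_apply

/-- The Randers functional `F(v) = √α(v, v) + β(v)`. -/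
def randersNorm (β : Π x : M, TangentSpace 𝓘(ℝ, E) x →L[ℝ] ℝ) (x : M)
    (v : TangentSpace 𝓘(ℝ, E) x) : ℝ :=
  √(inner ℝ v v) + β x v

variable [IsManifold 𝓘(ℝ, E) ∞ M]

/-- The one-form `β` defines a Randers metric `F = √α + β`: it is smooth and its dual vector field
has Riemannian length less than one. -/
structure IsRanders (β : Π x : M, TangentSpace 𝓘(ℝ, E) x →L[ℝ] ℝ) : Prop where
  smooth : IsSmoothOneForm β
  norm_sharp_lt_one : ∀ x, ‖sharp β x‖ < 1

/-- The (smooth) linear connection `D` is compatible with the Randers metric `F = √α + β`: its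
parallel transports along smooth curves preserve the Randers norm of tangent vectors. -/
structure IsCompatible (β : Π x : M, TangentSpace 𝓘(ℝ, E) x →L[ℝ] ℝ) (D : Connection E M) :
    Prop where
  smooth : CovariantDerivative.ContMDiffCovariantDerivative D ∞
  randersNorm_eq : ∀ (γ : ℝ → M) (a b : ℝ), a ≤ b →
    ContMDiffOn 𝓘(ℝ, ℝ) 𝓘(ℝ, E) ∞ γ (Set.Icc a b) →
    ∀ V : Π t : ℝ, TangentSpace 𝓘(ℝ, E) (γ t), IsParallelAlong D γ a b V →
      randersNorm β (γ b) (V b) = randersNorm β (γ a) (V a)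

/-- A generalized Berwald Randers metric: it admits a compatible linear connection. -/
def IsGeneralizedBerwald (β : Π x : M, TangentSpace 𝓘(ℝ, E) x →L[ℝ] ℝ) : Prop :=
  ∃ D : Connection E M, IsCompatible β D

/-- The squared norm `|T|²` at `x` of the torsion tensor of `D`: the sum of the squares of the
components of the tensor with respect to an orthonormal basis of the tangent space. -/
def torsionNormSq (D : Connection E M) (x : M) : ℝ :=
  let e := stdOrthonormalBasis ℝ (TangentSpace 𝓘(ℝ, E) x)
  ∑ i, ∑ j, ∑ k, (inner ℝ (D.torsion x (e i) (e j)) (e k)) ^ 2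

/-- `D` is an extremal compatible linear connection: it is compatible, and among all compatible
linear connections it minimizes the norm of the torsion tensor at each point. -/
structure IsExtremal (β : Π x : M, TangentSpace 𝓘(ℝ, E) x →L[ℝ] ℝ) (D : Connection E M) :
    Prop where
  compatible : IsCompatible β D
  minimal : ∀ D' : Connection E M, IsCompatible β D' →
    ∀ x, torsionNormSq D x ≤ torsionNormSq D' x

/-- `D` is metric, `∇α = 0`: one has `X(α(Y, Z)) = α(∇_X Y, Z) + α(Y, ∇_X Z)`. -/
def IsMetric (D : Connection E M) : Prop :=
  ∀ (x : M) (v : TangentSpace 𝓘(ℝ, E) x) (Y Z : Π x : M, TangentSpace 𝓘(ℝ, E) x),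
    IsSmoothField Y → IsSmoothField Z →
      mvfderiv 𝓘(ℝ, E) (fun y ↦ (inner ℝ (Y y) (Z y) : ℝ)) x v =
        inner ℝ (D Y x v) (Z x) + inner ℝ (Y x) (D Z x v)

/-- The Lévi-Civita connection: a smooth, metric and torsion-free linear connection. -/
structure IsLeviCivita (D : Connection E M) : Prop where
  smooth : CovariantDerivative.ContMDiffCovariantDerivative D ∞
  metric : IsMetric D
  torsion_free : ∀ x, D.torsion x = 0

/-- The difference tensor `A(X, Y) = (α(∇_X β♯, Y) β♯ - α(Y, β♯) ∇_X β♯) / K²`, with the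
argument order of Mathlib: `diffTensor D β K x Y X = A(X, Y)`. -/
def diffTensor (D : Connection E M) (β : Π x : M, TangentSpace 𝓘(ℝ, E) x →L[ℝ] ℝ) (K : ℝ)
    (x : M) : TangentSpace 𝓘(ℝ, E) x →L[ℝ] TangentSpace 𝓘(ℝ, E) x →L[ℝ] TangentSpace 𝓘(ℝ, E) x :=
  LinearMap.toContinuousLinearMap
    { toFun := fun Y ↦ (K ^ 2)⁻¹ • ((innerSL ℝ Y ∘L D (sharp β) x).smulRight (sharp β x)
        - inner ℝ Y (sharp β x) • D (sharp β) x)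
      map_add' := fun Y Y' ↦ by
        ext v
        simp only [_root_.smul_apply, _root_.add_apply,
          _root_.sub_apply, ContinuousLinearMap.smulRight_apply,
          ContinuousLinearMap.comp_apply, innerSL_apply_apply, inner_add_left]
        module
      map_smul' := fun c Y ↦ by
        ext v
        simp only [_root_.smul_apply,
          _root_.sub_apply, ContinuousLinearMap.smulRight_apply,
          ContinuousLinearMap.comp_apply, innerSL_apply_apply, inner_smul_left, RingHom.id_apply,
          conj_trivial]
        module }

lemma diffTensor_apply (D : Connection E M) (β : Π x : M, TangentSpace 𝓘(ℝ, E) x →L[ℝ] ℝ)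
    (K : ℝ) (x : M) (X Y : TangentSpace 𝓘(ℝ, E) x) :
    diffTensor D β K x Y X = (inner ℝ (D (sharp β) x X) Y / K ^ 2) • sharp β x
      - (inner ℝ Y (sharp β x) / K ^ 2) • D (sharp β) x X := by
  simp only [diffTensor, LinearMap.coe_toContinuousLinearMap', LinearMap.coe_mk, AddHom.coe_mk,
    _root_.smul_apply, _root_.sub_apply,
    ContinuousLinearMap.smulRight_apply, ContinuousLinearMap.comp_apply, innerSL_apply_apply,
    real_inner_comm Y]
  module

/-- The linear connection `∇°_X Y = ∇*_X Y + A(X, Y)`, where `D` plays the role of `∇*`. -/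
def circConnection (D : Connection E M) (β : Π x : M, TangentSpace 𝓘(ℝ, E) x →L[ℝ] ℝ) (K : ℝ) :
    Connection E M :=
  D.addOneForm (diffTensor D β K)

end Riemannian

end Randers

end

/-! The key is to linearise compatibility. If `V` is parallel, so is `-V`, and comparing F(V) with
F(-V) shows that parallel transport preserves √α and β separately. Hence a smooth connection is
compatible exactly when it is metric and β♯ is parallel (`isCompatible_of_isMetric`,
`IsCompatible.isMetric`, `IsCompatible.apply_sharp`). Since M is connected, |β♯| is then a constant
K, and K > 0 because β is nonzero somewhere. Removing the torsion of a compatible connection by a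
contorsion tensor gives the Lévi-Civita connection.

Two compatible connections differ by a tensor A for which every A_X is skew-symmetric and kills β♯,
and the torsion changes by the alternation A_X Y - A_Y X. Minimising |T| is thus a pointwise
least-squares problem, solved by any torsion orthogonal to all these alternations. It suffices that
α(T(X,Y),Z) be symmetric in Y, Z ⊥ β♯: a symmetric block is orthogonal to a skew one, and the other
components are paired with zero because A_X kills β♯ and has image in its complement.
`bilinNormSq_add` is the resulting Pythagorean identity.

The connection ∇° is metric and makes β♯ parallel. For Y, Z ⊥ β♯ its torsion reduces to β(X) α(∇*_Y
β♯, Z)/K². Subtracting the skew part of this in Y, Z is the job of `skewTensor`, and gives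
`extremalConnection`. It is unique on smooth fields because a tensor symmetric in its first two
slots and skew in its last two vanishes (`eq_zero_of_symm_of_skew`). Expanding the projections in
`skewTensor`, with dβ expressed through ∇*β♯, produces the stated torsion formula. -/

noncomputable section

namespace Randers

/-! ### Linear algebra: orthogonality of torsion-type tensors. -/

section TensorAlgebra

variable {V : Type*} [NormedAddCommGroup V] [InnerProductSpace ℝ V] {ι : Type*} [Fintype ι]

/-- The squared norm of a vector-valued bilinear map with respect to an orthonormal basis. -/
def bilinNormSq (e : OrthonormalBasis ι ℝ V) (T : V →L[ℝ] V →L[ℝ] V) : ℝ :=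
  ∑ i, ∑ j, ∑ k, (inner ℝ (T (e i) (e j)) (e k)) ^ 2

/-- A skew-symmetric endomorphism killing `B` is orthogonal to an endomorphism whose restriction
to the orthogonal complement of `B` is symmetric. -/
lemma sum_inner_mul_inner_eq_zero (e : OrthonormalBasis ι ℝ V) {B : V} (hB : B ≠ 0)
    (S N : V →L[ℝ] V) (hS : ∀ Y Z, inner ℝ Y B = 0 → inner ℝ Z B = 0 →
      inner ℝ (S Y) Z = inner ℝ (S Z) Y)
    (hN : ∀ Y Z, inner ℝ (N Y) Z = -inner ℝ (N Z) Y) (hNB : N B = 0) :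
    ∑ j, ∑ k, inner ℝ (S (e j)) (e k) * inner ℝ (N (e j)) (e k) = 0 := by
  have hBB : inner ℝ B B ≠ 0 := inner_self_ne_zero.mpr hB
  set c : V → ℝ := fun Y ↦ inner ℝ Y B / inner ℝ B B with hc
  set P : V → V := fun Y ↦ Y - c Y • B with hP
  have hPB (Y : V) : inner ℝ (P Y) B = 0 := by
    simp only [hP, hc, inner_sub_left, inner_smul_left, conj_trivial]
    field_simp
    ring
  -- Split `S` into its block on the complement of `B` and two terms carrying a `B`-coefficient `c`.
  -- The block is symmetric; the other terms vanish against `N`, whose image is orthogonal to `B` by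
  -- skewness and `N B = 0`.
  have hdecomp (Y Z : V) : inner ℝ (S Y) Z = inner ℝ (S (P Y)) (P Z)
      + c Y * inner ℝ (S B) (P Z) + c Z * inner ℝ (S Y) B := by
    have h1 : inner ℝ (S Y) Z = inner ℝ (S Y) (P Z) + c Z * inner ℝ (S Y) B := by
      simp only [hP, inner_sub_right, inner_smul_right]
      ring
    have h2 : S Y = S (P Y) + c Y • S B := by
      simp only [hP, map_sub, map_smul]
      abel
    rw [h1, h2, inner_add_left, inner_add_left, inner_smul_left, inner_smul_left]
    simp
  have hNk (Y : V) : ∑ k, c (e k) * inner ℝ (N Y) (e k) = 0 := by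
    have h : ∑ k, inner ℝ (N Y) (e k) * inner ℝ (e k) B = 0 := by
      rw [e.sum_inner_mul_inner, hN, hNB, inner_zero_left, neg_zero]
    calc ∑ k, c (e k) * inner ℝ (N Y) (e k)
        = (∑ k, inner ℝ (N Y) (e k) * inner ℝ (e k) B) / inner ℝ B B := by
          rw [Finset.sum_div]
          exact Finset.sum_congr rfl fun k _ ↦ by simp only [hc]; ring
      _ = 0 := by rw [h, zero_div]
  have hsym : ∑ j, ∑ k, inner ℝ (S (P (e j))) (P (e k)) * inner ℝ (N (e j)) (e k) = 0 := by
    -- Exchanging the summation indices fixes the symmetric factor and negates the skew one, so the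
    -- sum equals its own negative.
    have h : ∑ j, ∑ k, inner ℝ (S (P (e j))) (P (e k)) * inner ℝ (N (e j)) (e k)
        = -∑ j, ∑ k, inner ℝ (S (P (e j))) (P (e k)) * inner ℝ (N (e j)) (e k) := by
      conv_lhs => rw [Finset.sum_comm]
      rw [← Finset.sum_neg_distrib]
      refine Finset.sum_congr rfl fun j _ ↦ ?_
      rw [← Finset.sum_neg_distrib]
      refine Finset.sum_congr rfl fun k _ ↦ ?_
      rw [hS _ _ (hPB (e k)) (hPB (e j)), hN (e k) (e j)]
      ring
    linarith
  have hmid : ∑ j, ∑ k, c (e j) * inner ℝ (S B) (P (e k)) * inner ℝ (N (e j)) (e k) = 0 := by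
    rw [Finset.sum_comm]
    refine Finset.sum_eq_zero fun k _ ↦ ?_
    calc ∑ j, c (e j) * inner ℝ (S B) (P (e k)) * inner ℝ (N (e j)) (e k)
        = -inner ℝ (S B) (P (e k)) * ∑ j, c (e j) * inner ℝ (N (e k)) (e j) := by
          rw [Finset.mul_sum]
          refine Finset.sum_congr rfl fun j _ ↦ ?_
          rw [hN (e j) (e k)]
          ring
      _ = 0 := by rw [hNk, mul_zero]
  have hlast : ∑ j, ∑ k, c (e k) * inner ℝ (S (e j)) B * inner ℝ (N (e j)) (e k) = 0 := by
    refine Finset.sum_eq_zero fun j _ ↦ ?_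
    calc ∑ k, c (e k) * inner ℝ (S (e j)) B * inner ℝ (N (e j)) (e k)
        = inner ℝ (S (e j)) B * ∑ k, c (e k) * inner ℝ (N (e j)) (e k) := by
          rw [Finset.mul_sum]
          exact Finset.sum_congr rfl fun k _ ↦ by ring
      _ = 0 := by rw [hNk, mul_zero]
  calc _ = ∑ j, ∑ k, (inner ℝ (S (P (e j))) (P (e k)) * inner ℝ (N (e j)) (e k)
        + c (e j) * inner ℝ (S B) (P (e k)) * inner ℝ (N (e j)) (e k)
        + c (e k) * inner ℝ (S (e j)) B * inner ℝ (N (e j)) (e k)) := by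
        refine Finset.sum_congr rfl fun j _ ↦ Finset.sum_congr rfl fun k _ ↦ ?_
        rw [hdecomp (e j) (e k)]
        ring
    _ = 0 := by simp only [Finset.sum_add_distrib, hsym, hmid, hlast, add_zero]

/-- If `T` is alternating and each `T X` is symmetric on the orthogonal complement of `B`, then `T`
is orthogonal to the alternation of each `A` for which all `A X` are skew-symmetric and kill `B`. -/
lemma bilinNormSq_add (e : OrthonormalBasis ι ℝ V) {B : V} (hB : B ≠ 0)
    (T T' A : V →L[ℝ] V →L[ℝ] V) (hT : ∀ X Y, T X Y = -T Y X)
    (hTS : ∀ X Y Z, inner ℝ Y B = 0 → inner ℝ Z B = 0 → inner ℝ (T X Y) Z = inner ℝ (T X Z) Y)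
    (hA : ∀ X Y Z, inner ℝ (A X Y) Z = -inner ℝ (A X Z) Y) (hAB : ∀ X, A X B = 0)
    (hT' : ∀ X Y, T' X Y = T X Y + (A X Y - A Y X)) :
    bilinNormSq e T' = bilinNormSq e T + bilinNormSq e (A - A.flip) := by
  have h1 : ∑ i, ∑ j, ∑ k, inner ℝ (T (e i) (e j)) (e k) * inner ℝ (A (e i) (e j)) (e k) = 0 :=
    Finset.sum_eq_zero fun i _ ↦
      sum_inner_mul_inner_eq_zero e hB (T (e i)) (A (e i)) (hTS _) (hA _) (hAB _)
  have h2 : ∑ i, ∑ j, ∑ k, inner ℝ (T (e i) (e j)) (e k) * inner ℝ (A (e j) (e i)) (e k) = 0 := by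
    rw [Finset.sum_comm]
    rw [← neg_eq_zero, ← h1]
    simp only [← Finset.sum_neg_distrib]
    refine Finset.sum_congr rfl fun i _ ↦ Finset.sum_congr rfl fun j _ ↦
      Finset.sum_congr rfl fun k _ ↦ ?_
    rw [hT (e j) (e i), inner_neg_left]
    ring
  -- Expanding the square leaves a cross term with two halves; `h2` reduces to `h1` by exchanging
  -- `i` and `j`, as `T` is alternating.
  calc bilinNormSq e T' = bilinNormSq e T + bilinNormSq e (A - A.flip)
        + 2 * (∑ i, ∑ j, ∑ k, inner ℝ (T (e i) (e j)) (e k) * inner ℝ (A (e i) (e j)) (e k)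
        - ∑ i, ∑ j, ∑ k, inner ℝ (T (e i) (e j)) (e k) * inner ℝ (A (e j) (e i)) (e k)) := by
        simp only [bilinNormSq, Finset.mul_sum, ← Finset.sum_sub_distrib, ← Finset.sum_add_distrib]
        refine Finset.sum_congr rfl fun i _ ↦ Finset.sum_congr rfl fun j _ ↦
          Finset.sum_congr rfl fun k _ ↦ ?_
        simp only [hT', sub_apply, ContinuousLinearMap.flip_apply, inner_add_left, inner_sub_left]
        ring
    _ = _ := by rw [h1, h2]; ring

lemma bilinNormSq_nonneg (e : OrthonormalBasis ι ℝ V) (T : V →L[ℝ] V →L[ℝ] V) :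
    0 ≤ bilinNormSq e T :=
  Finset.sum_nonneg fun _ _ ↦ Finset.sum_nonneg fun _ _ ↦ Finset.sum_nonneg fun _ _ ↦ sq_nonneg _

lemma eq_zero_of_bilinNormSq_eq_zero (e : OrthonormalBasis ι ℝ V) {T : V →L[ℝ] V →L[ℝ] V}
    (h : bilinNormSq e T = 0) : T = 0 := by
  have h0 (i j k : ι) : inner ℝ (T (e i) (e j)) (e k) = 0 := by
    have h1 := (Finset.sum_eq_zero_iff_of_nonneg fun i _ ↦ Finset.sum_nonneg fun j _ ↦
      Finset.sum_nonneg fun k _ ↦ sq_nonneg (inner ℝ (T (e i) (e j)) (e k))).mp h i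
      (Finset.mem_univ _)
    have h2 := (Finset.sum_eq_zero_iff_of_nonneg fun j _ ↦
      Finset.sum_nonneg fun k _ ↦ sq_nonneg (inner ℝ (T (e i) (e j)) (e k))).mp h1 j
      (Finset.mem_univ _)
    exact pow_eq_zero_iff two_ne_zero |>.mp <| (Finset.sum_eq_zero_iff_of_nonneg fun k _ ↦
      sq_nonneg (inner ℝ (T (e i) (e j)) (e k))).mp h2 k (Finset.mem_univ _)
  have h1 (i j : ι) : T (e i) (e j) = 0 :=
    InnerProductSpace.ext_inner_right_basis e.toBasis fun k ↦ by simpa using h0 i j k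
  have h2 (i : ι) : T (e i) = 0 :=
    ContinuousLinearMap.coe_injective (e.toBasis.ext fun j ↦ by simpa using h1 i j)
  exact ContinuousLinearMap.coe_injective (e.toBasis.ext fun i ↦ by simpa using h2 i)

/-- A trilinear form which is symmetric in the first two and skew-symmetric in the last two
arguments vanishes. -/
lemma eq_zero_of_symm_of_skew {A : V →L[ℝ] V →L[ℝ] V} (hs : ∀ X Y, A X Y = A Y X)
    (hA : ∀ X Y Z, inner ℝ (A X Y) Z = -inner ℝ (A X Z) Y) : A = 0 := by
  ext X Y
  refine ext_inner_right ℝ fun Z ↦ ?_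
  -- Alternating the skew and the symmetric relation three times cycles the arguments back to the
  -- start with sign -1.
  have h1 := hA X Y Z
  have h2 := hA Z X Y
  have h3 := hA Y Z X
  rw [hs X Z] at h1
  rw [hs Z Y] at h2
  rw [hs Y X] at h3
  simp only [_root_.zero_apply, inner_zero_left]
  linarith

end TensorAlgebra

open Filter Topology

/-! ### Local frames of the tangent bundle and smoothness tests. -/

section Smoothness

variable {E : Type*} [NormedAddCommGroup E] [NormedSpace ℝ E] [FiniteDimensional ℝ E]
  {M : Type*} [TopologicalSpace M] [ChartedSpace E M]

/-- In finite dimension an operator is a finite sum of its values on a basis times fixed coordinate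
functionals. -/
lemma contMDiffAt_clm_of_apply {G : Type*} [NormedAddCommGroup G] [NormedSpace ℝ G]
    {n : ℕ∞ω} {f : M → E →L[ℝ] G} {x : M} (h : ∀ a, CMDiffAt n (fun y ↦ f y a) x) :
    CMDiffAt n f x := by
  set b := Module.finBasis ℝ E
  have hf : f = fun y ↦ ∑ i, ContinuousLinearMap.smulRightL ℝ E G
      (b.coord i).toContinuousLinearMap (f y (b i)) := by
    ext y a
    conv_lhs => rw [← b.sum_repr a, map_sum]
    simp
  rw [hf]
  refine ContMDiffAt.sum fun i _ ↦ ?_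
  exact (ContinuousLinearMap.contMDiff (ContinuousLinearMap.smulRightL ℝ E G
      (b.coord i).toContinuousLinearMap)).contMDiffAt.comp x (h (b i))

variable [IsManifold 𝓘(ℝ, E) ∞ M]

/-- The vector field with constant coordinate vector `a` in the trivialization of the tangent bundle
around `x₀`. -/
def frameField (x₀ : M) (a : E) (y : M) : TangentSpace 𝓘(ℝ, E) y :=
  (trivializationAt E (fun x : M ↦ TangentSpace 𝓘(ℝ, E) x) x₀).symm y a

/-- The coordinates of a tangent vector in the trivialization of the tangent bundle around `x₀`. -/
def coords (x₀ : M) {y : M} (v : TangentSpace 𝓘(ℝ, E) y) : E :=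
  ((trivializationAt E (fun x : M ↦ TangentSpace 𝓘(ℝ, E) x) x₀) ⟨y, v⟩).2

/-- The set over which the trivialization of the tangent bundle around `x₀` is defined. -/
def frameSet (E : Type*) [NormedAddCommGroup E] [NormedSpace ℝ E]
    {M : Type*} [TopologicalSpace M] [ChartedSpace E M] [IsManifold 𝓘(ℝ, E) ∞ M] (x₀ : M) : Set M :=
  (trivializationAt E (fun x : M ↦ TangentSpace 𝓘(ℝ, E) x) x₀).baseSet


omit [FiniteDimensional ℝ E] in
lemma isOpen_frameSet (x₀ : M) : IsOpen (frameSet E x₀) :=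
  (trivializationAt E (fun x : M ↦ TangentSpace 𝓘(ℝ, E) x) x₀).open_baseSet

omit [FiniteDimensional ℝ E] in
lemma mem_frameSet (x₀ : M) : x₀ ∈ frameSet E x₀ :=
  FiberBundle.mem_baseSet_trivializationAt' x₀

omit [FiniteDimensional ℝ E] in
lemma frameField_eq_symmL {x₀ y : M} (hy : y ∈ frameSet E x₀) (a : E) :
    frameField x₀ a y =
      (trivializationAt E (fun x : M ↦ TangentSpace 𝓘(ℝ, E) x) x₀).symmL ℝ y a :=
  ((trivializationAt E (fun x : M ↦ TangentSpace 𝓘(ℝ, E) x) x₀).symmL_apply hy a).symm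

omit [FiniteDimensional ℝ E] in
lemma coords_eq_continuousLinearMapAt {x₀ y : M} (hy : y ∈ frameSet E x₀)
    (v : TangentSpace 𝓘(ℝ, E) y) :
    coords x₀ v =
      (trivializationAt E (fun x : M ↦ TangentSpace 𝓘(ℝ, E) x) x₀).continuousLinearMapAt ℝ y v := by
  rw [Trivialization.continuousLinearMapAt_apply, Trivialization.coe_linearMapAt_of_mem _ hy]
  rfl

omit [FiniteDimensional ℝ E] in
lemma coords_frameField {x₀ y : M} (hy : y ∈ frameSet E x₀) (a : E) :
    coords x₀ (frameField x₀ a y) = a := by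
  rw [coords_eq_continuousLinearMapAt hy, frameField_eq_symmL hy]
  exact Trivialization.continuousLinearMapAt_symmL _ hy a

omit [FiniteDimensional ℝ E] in
lemma frameField_coords {x₀ y : M} (hy : y ∈ frameSet E x₀) (v : TangentSpace 𝓘(ℝ, E) y) :
    frameField x₀ (coords x₀ v) y = v := by
  rw [coords_eq_continuousLinearMapAt hy, frameField_eq_symmL hy]
  exact Trivialization.symmL_continuousLinearMapAt _ hy v

omit [FiniteDimensional ℝ E] in
lemma contMDiffAt_iff_coords {x₀ y : M} (hy : y ∈ frameSet E x₀)
    {X : Π x : M, TangentSpace 𝓘(ℝ, E) x} {n : ℕ∞ω}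
    [ContMDiffVectorBundle n E (fun x : M ↦ TangentSpace 𝓘(ℝ, E) x) 𝓘(ℝ, E)] :
    CMDiffAt n (T% X) y ↔ CMDiffAt n (fun z ↦ coords x₀ (X z)) y :=
  Trivialization.contMDiffAt_section_iff
    (trivializationAt E (fun x : M ↦ TangentSpace 𝓘(ℝ, E) x) x₀) hy

/-- The vector field `X` is smooth on a neighbourhood of `x`. -/
def SmoothNear (X : Π x : M, TangentSpace 𝓘(ℝ, E) x) (x : M) : Prop :=
  ∀ᶠ y in 𝓝 x, CMDiffAt ∞ (T% X) y

omit [FiniteDimensional ℝ E] in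
lemma SmoothNear.contMDiffAt {X : Π x : M, TangentSpace 𝓘(ℝ, E) x} {x : M}
    (h : SmoothNear X x) : CMDiffAt ∞ (T% X) x :=
  h.self_of_nhds

omit [FiniteDimensional ℝ E] in
lemma SmoothNear.mdifferentiableAt {X : Π x : M, TangentSpace 𝓘(ℝ, E) x} {x : M}
    (h : SmoothNear X x) : MDiffAt (T% X) x :=
  h.contMDiffAt.mdifferentiableAt (by simp)

omit [FiniteDimensional ℝ E] in
lemma SmoothNear.eventually {X : Π x : M, TangentSpace 𝓘(ℝ, E) x} {x : M}
    (h : SmoothNear X x) : ∀ᶠ y in 𝓝 x, SmoothNear X y :=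
  eventually_eventually_nhds.mpr h

omit [FiniteDimensional ℝ E] in
lemma IsSmoothField.smoothNear {X : Π x : M, TangentSpace 𝓘(ℝ, E) x} (h : IsSmoothField X)
    (x : M) : SmoothNear X x :=
  Eventually.of_forall h

omit [FiniteDimensional ℝ E] in
lemma smoothNear_frameField {x₀ y : M} (hy : y ∈ frameSet E x₀) (a : E) :
    SmoothNear (frameField x₀ a) y := by
  filter_upwards [(isOpen_frameSet x₀).mem_nhds hy] with z hz
  rw [contMDiffAt_iff_coords hz]
  refine contMDiffAt_const (c := a) |>.congr_of_eventuallyEq ?_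
  filter_upwards [(isOpen_frameSet x₀).mem_nhds hz] with w hw
  exact coords_frameField hw a

/-- A vector field which is smooth near a point agrees there with a globally smooth one. -/
lemma SmoothNear.exists_eventuallyEq [T2Space M] {X : Π x : M, TangentSpace 𝓘(ℝ, E) x} {x : M}
    (h : SmoothNear X x) :
    ∃ Y : Π x : M, TangentSpace 𝓘(ℝ, E) x, IsSmoothField Y ∧ ∀ᶠ y in 𝓝 x, Y y = X y := by
  obtain ⟨u, hu, huo, hxu⟩ := eventually_nhds_iff.mp h
  -- Multiply by a bump function equal to one near `x`, with topological support inside the open set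
  -- where `X` is smooth.
  obtain ⟨ψ, hψ, -⟩ := (SmoothBumpFunction.nhds_basis_support (I := 𝓘(ℝ, E))
    (huo.mem_nhds hxu)).mem_iff.mp (huo.mem_nhds hxu)
  refine ⟨(ψ : M → ℝ) • X, ContMDiffOn.smul_section_of_tsupport
    ψ.contMDiff.contMDiffOn huo hψ fun y hy ↦ (hu y hy).contMDiffWithinAt, ?_⟩
  filter_upwards [ψ.eventuallyEq_one] with y hy
  simp [hy]

lemma exists_smoothField_eq [T2Space M] {x : M} (v : TangentSpace 𝓘(ℝ, E) x) :
    ∃ Y : Π x : M, TangentSpace 𝓘(ℝ, E) x, IsSmoothField Y ∧ Y x = v := by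
  obtain ⟨Y, hY, h⟩ :=
    (smoothNear_frameField (mem_frameSet (E := E) x) (coords (E := E) x v)).exists_eventuallyEq
  exact ⟨Y, hY, by rw [h.self_of_nhds, frameField_coords (mem_frameSet (E := E) x)]⟩

/-- A section of `Hom(TM, TM)` is smooth if its values on a local frame are. -/
lemma contMDiffAt_hom_of_frameField {x : M}
    {φ : Π x : M, TangentSpace 𝓘(ℝ, E) x →L[ℝ] TangentSpace 𝓘(ℝ, E) x}
    (h : ∀ a : E, CMDiffAt ∞ (T% (fun y ↦ φ y (frameField x a y))) x) :
    ContMDiffAt 𝓘(ℝ, E) (𝓘(ℝ, E).prod 𝓘(ℝ, E →L[ℝ] E)) ∞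
      (fun y ↦ (⟨y, φ y⟩ : TotalSpace (E →L[ℝ] E)
        (fun y : M ↦ TangentSpace 𝓘(ℝ, E) y →L[ℝ] TangentSpace 𝓘(ℝ, E) y))) x := by
  rw [contMDiffAt_hom_bundle]
  refine ⟨contMDiffAt_id, contMDiffAt_clm_of_apply fun a ↦ ?_⟩
  have := (contMDiffAt_iff_coords (mem_frameSet x)).mp (h a)
  refine this.congr_of_eventuallyEq ?_
  filter_upwards [(isOpen_frameSet (E := E) x).mem_nhds (mem_frameSet x)] with y hy
  rw [coords_eq_continuousLinearMapAt hy, frameField_eq_symmL hy]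
  rfl

end Smoothness

/-! ### The Gram operator and smoothness of the dual field. -/

section RiemannianSmoothness

variable {E : Type*} [NormedAddCommGroup E] [NormedSpace ℝ E] [FiniteDimensional ℝ E]
  {M : Type*} [TopologicalSpace M] [ChartedSpace E M] [IsManifold 𝓘(ℝ, E) ∞ M]
  [RiemannianBundle (fun x : M ↦ TangentSpace 𝓘(ℝ, E) x)]

/-- The metric in the trivialization of the tangent bundle around `x₀`. -/
def gram (x₀ : M) (y : M) : E →L[ℝ] E →L[ℝ] ℝ :=
  (innerSL ℝ (E := TangentSpace 𝓘(ℝ, E) y)).bilinearComp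
    ((trivializationAt E (fun x : M ↦ TangentSpace 𝓘(ℝ, E) x) x₀).symmL ℝ y)
    ((trivializationAt E (fun x : M ↦ TangentSpace 𝓘(ℝ, E) x) x₀).symmL ℝ y)

omit [FiniteDimensional ℝ E] in
lemma gram_apply {x₀ y : M} (hy : y ∈ frameSet E x₀) (a b : E) :
    gram x₀ y a b = inner ℝ (frameField x₀ a y) (frameField x₀ b y) := by
  rw [frameField_eq_symmL hy, frameField_eq_symmL hy]
  rfl

/-- Positive definiteness gives injectivity, and E and its dual have equal dimension. -/
lemma isInvertible_gram {x₀ y : M} (hy : y ∈ frameSet E x₀) :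
    (gram (E := E) x₀ y).IsInvertible := by
  have hinj : Function.Injective (gram (E := E) x₀ y) := by
    rw [injective_iff_map_eq_zero]
    intro a ha
    have h : inner ℝ (frameField x₀ a y) (frameField x₀ a y) = 0 := by
      rw [← gram_apply hy, ha]; rfl
    have h' := coords_frameField hy a
    rw [inner_self_eq_zero.mp h, coords_eq_continuousLinearMapAt hy, map_zero] at h'
    exact h'.symm
  have hdim : Module.finrank ℝ E = Module.finrank ℝ (E →L[ℝ] ℝ) := by
    rw [← (LinearMap.toContinuousLinearMap (𝕜 := ℝ) (E := E) (F' := ℝ)).finrank_eq]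
    exact (Subspace.dual_finrank_eq (K := ℝ) (V := E)).symm
  refine ⟨(LinearEquiv.ofInjectiveOfFinrankEq (gram x₀ y).toLinearMap hinj
    hdim).toContinuousLinearEquiv, ?_⟩
  ext; rfl

variable [IsContMDiffRiemannianBundle 𝓘(ℝ, E) ∞ E (fun x : M ↦ TangentSpace 𝓘(ℝ, E) x)]

/-- A vector field is smooth if its inner products with a local frame are. -/
lemma contMDiffAt_of_inner_frameField {x : M} {X : Π x : M, TangentSpace 𝓘(ℝ, E) x}
    (h : ∀ a : E, CMDiffAt ∞ (fun y ↦ (inner ℝ (X y) (frameField x a y) : ℝ)) x) :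
    CMDiffAt ∞ (T% X) x := by
  rw [contMDiffAt_iff_coords (mem_frameSet x)]
  have hgram : CMDiffAt ∞ (gram (E := E) x) x := by
    refine contMDiffAt_clm_of_apply fun a ↦ contMDiffAt_clm_of_apply fun b ↦ ?_
    have hab : CMDiffAt ∞
        (fun y ↦ (inner ℝ (frameField (E := E) x a y) (frameField x b y) : ℝ)) x :=
      ContMDiffAt.inner_bundle (F := E) (smoothNear_frameField (mem_frameSet x) a).contMDiffAt
        (smoothNear_frameField (mem_frameSet x) b).contMDiffAt
    refine hab.congr_of_eventuallyEq ?_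
    filter_upwards [(isOpen_frameSet (E := E) x).mem_nhds (mem_frameSet x)] with y hy
    exact gram_apply hy a b
  -- The coordinates of `X` are the inverse Gram operator applied to its inner products with the
  -- frame, and inversion is smooth at invertible operators.
  have hinv : CMDiffAt ∞ (fun y ↦ (gram (E := E) x y).inverse) x :=
    (((isInvertible_gram (mem_frameSet x)).contDiffAt_map_inverse (n := ∞)).contMDiffAt).comp x
      hgram
  have hrhs : CMDiffAt ∞ (fun y ↦ gram x y (coords x (X y))) x := by
    refine contMDiffAt_clm_of_apply fun a ↦ (h a).congr_of_eventuallyEq ?_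
    filter_upwards [(isOpen_frameSet (E := E) x).mem_nhds (mem_frameSet x)] with y hy
    rw [gram_apply hy, frameField_coords hy]
  refine (hinv.clm_apply hrhs).congr_of_eventuallyEq ?_
  filter_upwards [(isOpen_frameSet (E := E) x).mem_nhds (mem_frameSet x)] with y hy
  rw [← ContinuousLinearMap.comp_apply, (isInvertible_gram hy).inverse_comp_self]
  rfl

lemma IsSmoothOneForm.isSmoothField_sharp {β : Π x : M, TangentSpace 𝓘(ℝ, E) x →L[ℝ] ℝ}
    (hβ : IsSmoothOneForm β) : IsSmoothField (sharp β) := by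
  intro x
  refine contMDiffAt_of_inner_frameField fun a ↦ ?_
  simp only [inner_sharp]
  have := ContMDiffAt.clm_bundle_apply (F₂ := ℝ) (E₂ := Bundle.Trivial M ℝ) (hβ x)
    (smoothNear_frameField (mem_frameSet x) a).contMDiffAt
  exact (contMDiffAt_totalSpace.mp this).2

end RiemannianSmoothness

/-! ### A product rule for families of linear maps. -/

section Calculus

variable {E F : Type*} [NormedAddCommGroup E] [NormedSpace ℝ E] [FiniteDimensional ℝ E]
  [NormedAddCommGroup F] [NormedSpace ℝ F]

/-- The product rule for a family of linear maps whose derivative is known pointwise. -/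
lemma hasDerivWithinAt_linearMap_apply {s : Set ℝ} {t : ℝ} (hs : UniqueDiffWithinAt ℝ s t)
    {h : ℝ → E →ₗ[ℝ] F} {h' : E → F} (hh : ∀ a, HasDerivWithinAt (fun r ↦ h r a) (h' a) s t)
    {w : ℝ → E} {w' : E} (hw : HasDerivWithinAt w w' s t) :
    HasDerivWithinAt (fun r ↦ h r (w r)) (h' (w t) + h t w') s t := by
  set b := Module.finBasis ℝ E
  have hsum (r : ℝ) (a : E) : h r a = ∑ i, b.coord i a • h r (b i) := by
    conv_lhs => rw [← b.sum_repr a, map_sum]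
    simp
  have hc (i) : HasDerivWithinAt (fun r ↦ b.coord i (w r)) (b.coord i w') s t :=
    (b.coord i).toContinuousLinearMap.hasFDerivAt.comp_hasDerivWithinAt t hw
  -- Linearity of `h'` is not assumed; uniqueness of derivatives forces this basis expansion.
  have h1 : h' (w t) = ∑ i, b.coord i (w t) • h' (b i) := by
    refine hs.eq_deriv _ (hh (w t)) ?_
    refine (HasDerivWithinAt.fun_sum (u := Finset.univ) fun i _ ↦
      (hh (b i)).const_smul (b.coord i (w t))).congr_of_eventuallyEq ?_ ?_
    · exact Eventually.of_forall fun r ↦ hsum r (w t)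
    · exact hsum t (w t)
  have h2 := HasDerivWithinAt.fun_sum (u := Finset.univ) fun i _ ↦ (hc i).smul (hh (b i))
  convert! h2.congr_of_eventuallyEq (Eventually.of_forall fun r ↦ hsum r (w r))
    (hsum t (w t)) using 1
  rw [h1, hsum t w', Finset.sum_add_distrib]

end Calculus

/-! ### Locality and smoothness of covariant derivatives. -/

section Connections

variable {E : Type*} [NormedAddCommGroup E] [NormedSpace ℝ E] [FiniteDimensional ℝ E]
  {M : Type*} [TopologicalSpace M] [ChartedSpace E M] [IsManifold 𝓘(ℝ, E) ∞ M]

omit [FiniteDimensional ℝ E] in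
lemma Connection.congr_of_eventuallyEq (D : Connection E M)
    {σ τ : Π x : M, TangentSpace 𝓘(ℝ, E) x} {x : M} (hσ : MDiffAt (T% σ) x)
    (hτ : MDiffAt (T% τ) x) (h : ∀ᶠ y in 𝓝 x, σ y = τ y) : D σ x = D τ x :=
  D.isCovariantDerivativeOnUniv.congr_of_eventuallyEq hσ hτ univ_mem h

/-- Smoothness of `D` is applied to a globally smooth field agreeing with σ near the point; locality
then transfers the conclusion to σ. -/
lemma Connection.smoothNear [T2Space M] {D : Connection E M}
    (hD : CovariantDerivative.ContMDiffCovariantDerivative D ∞)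
    {σ X : Π x : M, TangentSpace 𝓘(ℝ, E) x} {x : M} (hσ : SmoothNear σ x) (hX : SmoothNear X x) :
    SmoothNear (fun y ↦ D σ y (X y)) x := by
  obtain ⟨Y, hY, hYσ⟩ := hσ.exists_eventuallyEq
  have hDY := hD.contMDiff.contMDiff (σ := Y) (by simpa using! hY.contMDiffOn)
  have hDYσ : ∀ᶠ y in 𝓝 x, D σ y = D Y y := by
    filter_upwards [hσ.eventually, eventually_eventually_nhds.mpr hYσ] with y hy hy'
    exact D.congr_of_eventuallyEq hy.mdifferentiableAt (hY.smoothNear y).mdifferentiableAt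
      (hy'.mono fun _ h ↦ h.symm)
  filter_upwards [eventually_eventually_nhds.mpr hDYσ, hX] with y hy hXy
  have h := ContMDiffAt.clm_bundle_apply (hDY.contMDiffAt (x := y) univ_mem) hXy
  refine h.congr_of_eventuallyEq ?_
  filter_upwards [hy] with z hz
  rw [hz]

omit [FiniteDimensional ℝ E] [IsManifold 𝓘(ℝ, E) ∞ M] in
/-- The derivative of a function along a curve. -/
lemma hasDerivWithinAt_comp_curve {f : M → ℝ} {γ : ℝ → M} {s : Set ℝ} {t : ℝ}
    (hf : MDiffAt f (γ t)) (hγ : MDifferentiableWithinAt 𝓘(ℝ, ℝ) 𝓘(ℝ, E) γ s t) :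
    HasDerivWithinAt (fun r ↦ f (γ r))
      (mvfderiv 𝓘(ℝ, E) f (γ t) (mfderivWithin 𝓘(ℝ, ℝ) 𝓘(ℝ, E) γ s t (1 : ℝ))) s t := by
  let L : ℝ →L[ℝ] ℝ := (mvfderiv 𝓘(ℝ, E) f (γ t)).comp (mfderivWithin 𝓘(ℝ, ℝ) 𝓘(ℝ, E) γ s t)
  have h : HasFDerivWithinAt (fun r ↦ f (γ r)) L s t :=
    hasMFDerivWithinAt_iff_hasFDerivWithinAt.mp
      (hf.hasMFDerivAt.comp_hasMFDerivWithinAt t hγ.hasMFDerivWithinAt)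
  exact h.hasDerivWithinAt

end Connections

/-! ### The covariant derivative of α and its effect on parallel fields. -/

section MetricConnections

variable {E : Type*} [NormedAddCommGroup E] [NormedSpace ℝ E] [FiniteDimensional ℝ E]
  {M : Type*} [TopologicalSpace M] [ChartedSpace E M] [IsManifold 𝓘(ℝ, E) ∞ M]
  [RiemannianBundle (fun x : M ↦ TangentSpace 𝓘(ℝ, E) x)]
  [IsContMDiffRiemannianBundle 𝓘(ℝ, E) ∞ E (fun x : M ↦ TangentSpace 𝓘(ℝ, E) x)]

omit [FiniteDimensional ℝ E] in
lemma mdifferentiableAt_inner {x : M} {σ τ : Π x : M, TangentSpace 𝓘(ℝ, E) x}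
    (hσ : MDiffAt (T% σ) x) (hτ : MDiffAt (T% τ) x) :
    MDiffAt (fun y ↦ (inner ℝ (σ y) (τ y) : ℝ)) x :=
  MDifferentiableAt.inner_bundle (F := E) (E := fun x : M ↦ TangentSpace 𝓘(ℝ, E) x) hσ hτ

omit [FiniteDimensional ℝ E] in
lemma contMDiffAt_inner {x : M} {σ τ : Π x : M, TangentSpace 𝓘(ℝ, E) x}
    (hσ : CMDiffAt ∞ (T% σ) x) (hτ : CMDiffAt ∞ (T% τ) x) :
    CMDiffAt ∞ (fun y ↦ (inner ℝ (σ y) (τ y) : ℝ)) x :=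
  ContMDiffAt.inner_bundle (F := E) (E := fun x : M ↦ TangentSpace 𝓘(ℝ, E) x) hσ hτ

/-- The covariant derivative of the metric. -/
def metricDefect (D : Connection E M) (x : M) (v w u : TangentSpace 𝓘(ℝ, E) x) : ℝ :=
  CovariantDerivative.derivMetricTensor (V := fun x : M ↦ TangentSpace 𝓘(ℝ, E) x) D x v w u

lemma mvfderiv_inner_eq (D : Connection E M) {x : M} {σ τ : Π x : M, TangentSpace 𝓘(ℝ, E) x}
    (hσ : MDiffAt (T% σ) x) (hτ : MDiffAt (T% τ) x) (u : TangentSpace 𝓘(ℝ, E) x) :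
    mvfderiv 𝓘(ℝ, E) (fun y ↦ (inner ℝ (σ y) (τ y) : ℝ)) x u =
      inner ℝ (D σ x u) (τ x) + inner ℝ (σ x) (D τ x u) + metricDefect D x (σ x) (τ x) u := by
  have h := CovariantDerivative.derivMetricTensor_apply (V := fun x : M ↦ TangentSpace 𝓘(ℝ, E) x)
    D (X := FiberBundle.extend E u) x hσ hτ
  simp only [FiberBundle.extend_apply_self] at h
  rw [metricDefect, h]
  ring

/-- The defect is tensorial, so testing on globally smooth fields is the same as testing on vectors
at a point. -/
lemma isMetric_iff [T2Space M] {D : Connection E M} :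
    IsMetric D ↔ ∀ (x : M) (v w u : TangentSpace 𝓘(ℝ, E) x), metricDefect D x v w u = 0 := by
  constructor
  · intro h x v w u
    obtain ⟨Y, hY, rfl⟩ := exists_smoothField_eq v
    obtain ⟨Z, hZ, rfl⟩ := exists_smoothField_eq w
    have h1 := h x u Y Z hY hZ
    have h2 := mvfderiv_inner_eq D (hY.smoothNear x).mdifferentiableAt
      (hZ.smoothNear x).mdifferentiableAt u
    linarith
  · intro h x u Y Z hY hZ
    rw [mvfderiv_inner_eq D (hY.smoothNear x).mdifferentiableAt
      (hZ.smoothNear x).mdifferentiableAt u, h, add_zero]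

lemma IsMetric.mvfderiv_inner [T2Space M] {D : Connection E M} (hD : IsMetric D) {x : M}
    {σ τ : Π x : M, TangentSpace 𝓘(ℝ, E) x}
    (hσ : MDiffAt (T% σ) x) (hτ : MDiffAt (T% τ) x) (u : TangentSpace 𝓘(ℝ, E) x) :
    mvfderiv 𝓘(ℝ, E) (fun y ↦ (inner ℝ (σ y) (τ y) : ℝ)) x u =
      inner ℝ (D σ x u) (τ x) + inner ℝ (σ x) (D τ x u) := by
  rw [mvfderiv_inner_eq D hσ hτ u, isMetric_iff.mp hD, add_zero]

lemma metricDefect_comm (D : Connection E M) (x : M) (v w u : TangentSpace 𝓘(ℝ, E) x) :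
    metricDefect D x v w u = metricDefect D x w v u := by
  have hs (v : TangentSpace 𝓘(ℝ, E) x) := (smoothNear_frameField (mem_frameSet (E := E) x)
    (coords x v)).mdifferentiableAt
  have h1 := mvfderiv_inner_eq D (hs v) (hs w) u
  have h2 := mvfderiv_inner_eq D (hs w) (hs v) u
  rw [show (fun y ↦ (inner ℝ (frameField x (coords x w) y) (frameField x (coords x v) y) : ℝ)) =
    fun y ↦ (inner ℝ (frameField x (coords x v) y) (frameField x (coords x w) y) : ℝ) from
    funext fun y ↦ real_inner_comm _ _, h1] at h2
  simp only [frameField_coords (mem_frameSet (E := E) x)] at h2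
  linarith [real_inner_comm v (D (frameField x (coords x w)) x u),
    real_inner_comm w (D (frameField x (coords x v)) x u)]

lemma metricDefect_add_left (D : Connection E M) (x : M) (v v' w u : TangentSpace 𝓘(ℝ, E) x) :
    metricDefect D x (v + v') w u = metricDefect D x v w u + metricDefect D x v' w u := by
  have h := ContinuousLinearMap.map_add
    (CovariantDerivative.derivMetricTensor (V := fun x : M ↦ TangentSpace 𝓘(ℝ, E) x) D x) v v'
  exact congrArg (fun T ↦ T w u) h

/-- Polarisation: preservation of lengths only gives information on the diagonal. -/
lemma metricDefect_eq_zero_of_diag {D : Connection E M} {x : M} {u : TangentSpace 𝓘(ℝ, E) x}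
    (h : ∀ v, metricDefect D x v v u = 0) (v w : TangentSpace 𝓘(ℝ, E) x) :
    metricDefect D x v w u = 0 := by
  have h1 := h (v + w)
  rw [metricDefect_add_left, metricDefect_comm D x v, metricDefect_comm D x w,
    metricDefect_add_left, metricDefect_add_left, h v, h w, metricDefect_comm D x w] at h1
  linarith

variable {D : Connection E M} {γ : ℝ → M} {a b : ℝ} {V : Π t : ℝ, TangentSpace 𝓘(ℝ, E) (γ t)}

/-- The derivative of the squared length of a parallel vector field along a curve. -/
lemma IsParallelAlong.hasDerivWithinAt_inner_self (hab : a < b)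
    (hγ : MDifferentiableOn 𝓘(ℝ, ℝ) 𝓘(ℝ, E) γ (Set.Icc a b)) (hV : IsParallelAlong D γ a b V)
    {t : ℝ} (ht : t ∈ Set.Icc a b) :
    HasDerivWithinAt (fun r ↦ (inner ℝ (V r) (V r) : ℝ))
      (metricDefect D (γ t) (V t) (V t)
        (mfderivWithin 𝓘(ℝ, ℝ) 𝓘(ℝ, E) γ (Set.Icc a b) t (1 : ℝ))) (Set.Icc a b) t := by
  obtain ⟨x₀, hx₀, hw⟩ := hV t ht
  have hu : UniqueDiffWithinAt ℝ (Set.Icc a b) t := uniqueDiffOn_Icc hab t ht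
  set u := mfderivWithin 𝓘(ℝ, ℝ) 𝓘(ℝ, E) γ (Set.Icc a b) t (1 : ℝ)
  let w : ℝ → E := fun r ↦ coords x₀ (V r)
  let w' : E := -coords x₀ (D (frameField x₀ (w t)) (γ t) u)
  have hw : HasDerivWithinAt w w' (Set.Icc a b) t := hw
  have hmem : ∀ᶠ r in 𝓝[Set.Icc a b] t, γ r ∈ frameSet E x₀ :=
    (hγ t ht).continuousWithinAt ((isOpen_frameSet x₀).mem_nhds hx₀)
  have hsm (c : E) : MDiffAt (T% (frameField x₀ c)) (γ t) :=
    (smoothNear_frameField hx₀ c).mdifferentiableAt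
  have hVt : frameField x₀ (w t) (γ t) = V t := frameField_coords hx₀ (V t)
  have h0 (c d : E) : HasDerivWithinAt (fun r ↦ gram x₀ (γ r) c d)
      (mvfderiv 𝓘(ℝ, E)
        (fun y ↦ (inner ℝ (frameField x₀ c y) (frameField x₀ d y) : ℝ)) (γ t) u)
      (Set.Icc a b) t := by
    refine (hasDerivWithinAt_comp_curve
      (mdifferentiableAt_inner (hsm c) (hsm d)) (hγ t ht)).congr_of_eventuallyEq
      ?_ (gram_apply hx₀ c d)
    filter_upwards [hmem] with r hr
    exact gram_apply hr c d
  have h1 (d : E) : HasDerivWithinAt (fun r ↦ gram x₀ (γ r) (w r) d)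
      (mvfderiv 𝓘(ℝ, E)
        (fun y ↦ (inner ℝ (frameField x₀ (w t) y) (frameField x₀ d y) : ℝ)) (γ t) u
        + gram x₀ (γ t) w' d) (Set.Icc a b) t :=
    hasDerivWithinAt_linearMap_apply hu
      (h := fun r ↦ ((gram x₀ (γ r)).flip d).toLinearMap)
      (h' := fun c ↦ mvfderiv 𝓘(ℝ, E)
        (fun y ↦ (inner ℝ (frameField x₀ c y) (frameField x₀ d y) : ℝ)) (γ t) u)
      (fun c ↦ h0 c d) hw
  have h2 : HasDerivWithinAt (fun r ↦ gram x₀ (γ r) (w r) (w r))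
      (mvfderiv 𝓘(ℝ, E)
        (fun y ↦ (inner ℝ (frameField x₀ (w t) y) (frameField x₀ (w t) y) : ℝ)) (γ t) u
        + gram x₀ (γ t) w' (w t) + gram x₀ (γ t) (w t) w') (Set.Icc a b) t :=
    hasDerivWithinAt_linearMap_apply hu
    (h := fun r ↦ (gram x₀ (γ r) (w r)).toLinearMap) h1 hw
  refine (h2.congr_of_eventuallyEq (f₁ := fun r ↦ (inner ℝ (V r) (V r) : ℝ)) ?_ ?_).congr_deriv ?_
  · filter_upwards [hmem] with r hr
    exact (by rw [gram_apply hr, frameField_coords hr] :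
      gram x₀ (γ r) (w r) (w r) = inner ℝ (V r) (V r)).symm
  · exact (by rw [gram_apply hx₀, frameField_coords hx₀] :
      gram x₀ (γ t) (w t) (w t) = inner ℝ (V t) (V t)).symm
  -- The two Christoffel terms from differentiating the frame cancel those from `w'`, leaving the
  -- defect.
  · rw [mvfderiv_inner_eq D (hsm _) (hsm _), map_neg, map_neg, _root_.neg_apply, gram_apply hx₀,
      gram_apply hx₀, hVt, frameField_coords hx₀]
    ring

/-- The derivative of the inner product of a parallel vector field along a curve with a given
vector field. -/
lemma IsParallelAlong.hasDerivWithinAt_inner (hab : a < b)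
    (hγ : MDifferentiableOn 𝓘(ℝ, ℝ) 𝓘(ℝ, E) γ (Set.Icc a b)) (hV : IsParallelAlong D γ a b V)
    {t : ℝ} (ht : t ∈ Set.Icc a b) {B : Π x : M, TangentSpace 𝓘(ℝ, E) x}
    (hB : MDiffAt (T% B) (γ t)) :
    HasDerivWithinAt (fun r ↦ (inner ℝ (B (γ r)) (V r) : ℝ))
      (inner ℝ (D B (γ t) (mfderivWithin 𝓘(ℝ, ℝ) 𝓘(ℝ, E) γ (Set.Icc a b) t (1 : ℝ))) (V t)
        + metricDefect D (γ t) (B (γ t)) (V t)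
        (mfderivWithin 𝓘(ℝ, ℝ) 𝓘(ℝ, E) γ (Set.Icc a b) t (1 : ℝ))) (Set.Icc a b) t := by
  obtain ⟨x₀, hx₀, hw⟩ := hV t ht
  have hu : UniqueDiffWithinAt ℝ (Set.Icc a b) t := uniqueDiffOn_Icc hab t ht
  set u := mfderivWithin 𝓘(ℝ, ℝ) 𝓘(ℝ, E) γ (Set.Icc a b) t (1 : ℝ)
  let w : ℝ → E := fun r ↦ coords x₀ (V r)
  let w' : E := -coords x₀ (D (frameField x₀ (w t)) (γ t) u)
  have hw : HasDerivWithinAt w w' (Set.Icc a b) t := hw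
  have hmem : ∀ᶠ r in 𝓝[Set.Icc a b] t, γ r ∈ frameSet E x₀ :=
    (hγ t ht).continuousWithinAt ((isOpen_frameSet x₀).mem_nhds hx₀)
  have hsm (c : E) : MDiffAt (T% (frameField x₀ c)) (γ t) :=
    (smoothNear_frameField hx₀ c).mdifferentiableAt
  have hVt : frameField x₀ (w t) (γ t) = V t := frameField_coords hx₀ (V t)
  have h0 (d : E) : HasDerivWithinAt (fun r ↦ gram x₀ (γ r) (coords x₀ (B (γ r))) d)
      (mvfderiv 𝓘(ℝ, E)
        (fun y ↦ (inner ℝ (B y) (frameField x₀ d y) : ℝ)) (γ t) u)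
      (Set.Icc a b) t := by
    refine (hasDerivWithinAt_comp_curve
      (mdifferentiableAt_inner hB (hsm d)) (hγ t ht)).congr_of_eventuallyEq
      ?_ ?_
    · filter_upwards [hmem] with r hr
      rw [gram_apply hr, frameField_coords hr]
    · rw [gram_apply hx₀, frameField_coords hx₀]
  have h2 : HasDerivWithinAt (fun r ↦ gram x₀ (γ r) (coords x₀ (B (γ r))) (w r))
      (mvfderiv 𝓘(ℝ, E) (fun y ↦ (inner ℝ (B y) (frameField x₀ (w t) y) : ℝ)) (γ t) u
        + gram x₀ (γ t) (coords x₀ (B (γ t))) w') (Set.Icc a b) t :=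
    hasDerivWithinAt_linearMap_apply hu
      (h := fun r ↦ (gram x₀ (γ r) (coords x₀ (B (γ r)))).toLinearMap) h0 hw
  refine (h2.congr_of_eventuallyEq (f₁ := fun r ↦ (inner ℝ (B (γ r)) (V r) : ℝ))
    ?_ ?_).congr_deriv ?_
  · filter_upwards [hmem] with r hr
    exact (by rw [gram_apply hr, frameField_coords hr, frameField_coords hr] :
      gram x₀ (γ r) (coords x₀ (B (γ r))) (w r) = inner ℝ (B (γ r)) (V r)).symm
  · exact (by rw [gram_apply hx₀, frameField_coords hx₀, frameField_coords hx₀] :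
      gram x₀ (γ t) (coords x₀ (B (γ t))) (w t) = inner ℝ (B (γ t)) (V t)).symm
  · rw [mvfderiv_inner_eq D hB (hsm _), map_neg, gram_apply hx₀, hVt, frameField_coords hx₀,
      frameField_coords hx₀]
    ring

end MetricConnections

/-! ### Straight lines in a chart as test curves. -/

section ChartCurve

variable {E : Type*} [NormedAddCommGroup E] [NormedSpace ℝ E]
  {M : Type*} [TopologicalSpace M] [ChartedSpace E M] [IsManifold 𝓘(ℝ, E) ∞ M]

omit [IsManifold 𝓘(ℝ, E) ∞ M] in
/-- The straight line through `x` with direction `u` in the chart around `x`. -/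
def chartCurve (x : M) (u : E) (t : ℝ) : M :=
  (extChartAt 𝓘(ℝ, E) x).symm (extChartAt 𝓘(ℝ, E) x x + t • u)

omit [IsManifold 𝓘(ℝ, E) ∞ M] in
lemma chartCurve_zero (x : M) (u : E) : chartCurve x u 0 = x := by
  simp [chartCurve]

omit [IsManifold 𝓘(ℝ, E) ∞ M] in
lemma eventually_mem_target (x : M) (u : E) :
    ∀ᶠ t : ℝ in 𝓝 0, extChartAt 𝓘(ℝ, E) x x + t • u ∈ (extChartAt 𝓘(ℝ, E) x).target := by
  have hc : ContinuousAt (fun t : ℝ ↦ extChartAt 𝓘(ℝ, E) x x + t • u) 0 := by fun_prop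
  exact hc ((isOpen_extChartAt_target x).mem_nhds (by simp))

variable {x : M} {u : E} {t : ℝ}
  (ht : extChartAt 𝓘(ℝ, E) x x + t • u ∈ (extChartAt 𝓘(ℝ, E) x).target)

include ht

lemma chartCurve_mem_frameSet : chartCurve x u t ∈ frameSet E x := by
  have h := (extChartAt 𝓘(ℝ, E) x).map_target ht
  rwa [extChartAt_source] at h

lemma contMDiffAt_chartCurve : ContMDiffAt 𝓘(ℝ, ℝ) 𝓘(ℝ, E) ∞ (chartCurve x u) t := by
  have h := (contMDiffOn_extChartAt_symm (I := 𝓘(ℝ, E)) (n := ∞) x).contMDiffAt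
    ((isOpen_extChartAt_target x).mem_nhds ht)
  have h' : ContDiff ℝ ∞ (fun t : ℝ ↦ extChartAt 𝓘(ℝ, E) x x + t • u) := by fun_prop
  exact h.comp t h'.contMDiff.contMDiffAt

lemma mfderiv_chartCurve :
    mfderiv 𝓘(ℝ, ℝ) 𝓘(ℝ, E) (chartCurve x u) t (1 : ℝ) = frameField x u (chartCurve x u t) := by
  have h := (contMDiffOn_extChartAt_symm (I := 𝓘(ℝ, E)) (n := ∞) x).contMDiffAt
    ((isOpen_extChartAt_target x).mem_nhds ht) |>.mdifferentiableAt (by simp)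
  have h' : HasDerivAt (fun t : ℝ ↦ extChartAt 𝓘(ℝ, E) x x + t • u) u t := by
    simpa using ((hasDerivAt_id t).smul_const u).const_add (extChartAt 𝓘(ℝ, E) x x)
  have h'' := h.hasMFDerivAt.comp t h'.hasFDerivAt.hasMFDerivAt
  have hy : chartCurve x u t ∈ (chartAt E x).source := chartCurve_mem_frameSet ht
  have hr : extChartAt 𝓘(ℝ, E) x (chartCurve x u t) = extChartAt 𝓘(ℝ, E) x x + t • u :=
    (extChartAt 𝓘(ℝ, E) x).right_inv ht
  rw [frameField_eq_symmL (chartCurve_mem_frameSet ht)]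
  -- The inverse trivialization at a point is the differential of the inverse chart, so coordinate
  -- lines have velocity with constant coordinates.
  have hs := TangentBundle.symmL_trivializationAt (I := 𝓘(ℝ, E)) hy
  have h1 : mfderiv 𝓘(ℝ, ℝ) 𝓘(ℝ, E) (chartCurve x u) t (1 : ℝ) =
    mfderiv 𝓘(ℝ, E) 𝓘(ℝ, E) (extChartAt 𝓘(ℝ, E) x).symm (extChartAt 𝓘(ℝ, E) x x + t • u) u := by
    have := congrArg (fun L ↦ L (1 : ℝ)) h''.mfderiv
    refine this.trans ?_
    change mfderiv 𝓘(ℝ, E) 𝓘(ℝ, E) (extChartAt 𝓘(ℝ, E) x).symm (extChartAt 𝓘(ℝ, E) x x + t • u)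
      ((1 : ℝ) • u) = _
    rw [one_smul]
  rw [h1]
  have h2 := congrArg (fun L ↦ L u) hs
  refine Eq.trans ?_ h2.symm
  rw [hr, ModelWithCorners.range_eq_univ, mfderivWithin_univ]
  rfl

end ChartCurve

/-! ### Christoffel symbols and short-time parallel transport. -/

section ParallelTransport

variable {E : Type*} [NormedAddCommGroup E] [NormedSpace ℝ E]
  {M : Type*} [TopologicalSpace M] [ChartedSpace E M] [IsManifold 𝓘(ℝ, E) ∞ M]

lemma frameField_add {x₀ y : M} (hy : y ∈ frameSet E x₀) (a b : E) :
    frameField x₀ (a + b) y = frameField x₀ a y + frameField x₀ b y := by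
  simp only [frameField_eq_symmL hy, map_add]

lemma frameField_smul {x₀ y : M} (hy : y ∈ frameSet E x₀) (c : ℝ) (a : E) :
    frameField x₀ (c • a) y = c • frameField x₀ a y := by
  simp only [frameField_eq_symmL hy, map_smul]

/-- The Christoffel symbols of `D` in the trivialization around `x₀`, contracted with `u`. -/
def christoffel (D : Connection E M) (x₀ : M) (u : E) (y : M) (a : E) : E :=
  coords x₀ (D (frameField x₀ a) y (frameField x₀ u y))

lemma christoffel_add (D : Connection E M) {x₀ y : M} (hy : y ∈ frameSet E x₀) (u a b : E) :
    christoffel D x₀ u y (a + b) = christoffel D x₀ u y a + christoffel D x₀ u y b := by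
  have hs (c : E) := (smoothNear_frameField hy c).mdifferentiableAt
  have h : D (frameField x₀ (a + b)) y = D (frameField x₀ a) y + D (frameField x₀ b) y := by
    rw [← D.isCovariantDerivativeOnUniv.add (hs a) (hs b)]
    refine D.congr_of_eventuallyEq (hs _) (mdifferentiableAt_add_section (hs a) (hs b)) ?_
    filter_upwards [(isOpen_frameSet x₀).mem_nhds hy] with z hz
    exact frameField_add hz a b
  rw [christoffel, h]
  simp only [christoffel, coords_eq_continuousLinearMapAt hy, _root_.add_apply, map_add]

lemma christoffel_smul (D : Connection E M) {x₀ y : M} (hy : y ∈ frameSet E x₀) (u : E) (c : ℝ)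
    (a : E) : christoffel D x₀ u y (c • a) = c • christoffel D x₀ u y a := by
  have hs (c : E) := (smoothNear_frameField hy c).mdifferentiableAt
  have h : D (frameField x₀ (c • a)) y = c • D (frameField x₀ a) y := by
    rw [← D.isCovariantDerivativeOnUniv.smul_const c (hs a)]
    refine D.congr_of_eventuallyEq (hs _)
      (MDifferentiableAt.smul_section (f := fun _ ↦ c) mdifferentiableAt_const (hs a)) ?_
    filter_upwards [(isOpen_frameSet x₀).mem_nhds hy] with z hz
    exact frameField_smul hz c a
  rw [christoffel, h]
  simp only [christoffel, coords_eq_continuousLinearMapAt hy, _root_.smul_apply, map_smul]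

variable [FiniteDimensional ℝ E]

/-- The Christoffel symbols as a continuous linear map. -/
def christoffelCLM (D : Connection E M) (x₀ : M) (u : E) (y : M) : E →L[ℝ] E :=
  ∑ i, ((Module.finBasis ℝ E).coord i).toContinuousLinearMap.smulRight
    (christoffel D x₀ u y (Module.finBasis ℝ E i))

lemma christoffelCLM_apply (D : Connection E M) {x₀ y : M} (hy : y ∈ frameSet E x₀) (u a : E) :
    christoffelCLM D x₀ u y a = christoffel D x₀ u y a := by
  let L : E →ₗ[ℝ] E := {
    toFun := christoffel D x₀ u y
    map_add' := christoffel_add D hy u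
    map_smul' := christoffel_smul D hy u }
  have h : L a = ∑ i, (Module.finBasis ℝ E).coord i a • L (Module.finBasis ℝ E i) := by
    conv_lhs => rw [← (Module.finBasis ℝ E).sum_repr a, map_sum]
    simp
  change _ = L a
  rw [h]
  simp [christoffelCLM, L]

lemma contMDiffAt_christoffelCLM [T2Space M] {D : Connection E M}
    (hD : CovariantDerivative.ContMDiffCovariantDerivative D ∞) (x : M) (u : E) :
    CMDiffAt ∞ (christoffelCLM D x u) x := by
  refine contMDiffAt_clm_of_apply fun a ↦ ?_
  have h := Connection.smoothNear hD (smoothNear_frameField (mem_frameSet (E := E) x) a)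
    (smoothNear_frameField (mem_frameSet (E := E) x) u)
  refine ((contMDiffAt_iff_coords (mem_frameSet x)).mp h.contMDiffAt).congr_of_eventuallyEq ?_
  filter_upwards [(isOpen_frameSet (E := E) x).mem_nhds (mem_frameSet x)] with y hy
  exact christoffelCLM_apply D hy u a

/-- Local existence of solutions of a linear differential equation. -/
lemma exists_hasDerivAt_linear {A : ℝ → E →L[ℝ] E} (hA : ContDiffAt ℝ 1 A 0) (w₀ : E) :
    ∃ w : ℝ → E, w 0 = w₀ ∧ ∃ ε > 0, ∀ t ∈ Set.Ico 0 ε, HasDerivAt w (A t (w t)) t := by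
  -- The time-dependent equation is made autonomous by adding time as a coordinate of velocity one;
  -- below, that coordinate is shown to equal `t`.
  have hF : ContDiffAt ℝ 1 (fun p : ℝ × E ↦ ((1 : ℝ), A p.1 p.2)) (0, w₀) := by
    refine contDiffAt_const.prodMk (ContDiffAt.clm_apply ?_ contDiffAt_snd)
    exact ContDiffAt.comp (0, w₀) (f := Prod.fst) hA contDiffAt_fst
  obtain ⟨α, hα0, ε, hε, hα⟩ :=
    hF.exists_forall_mem_closedBall_exists_eq_forall_mem_Ioo_hasDerivAt₀ 0
  have hα1 (t : ℝ) (ht : t ∈ Set.Ioo (0 - ε) (0 + ε)) : HasDerivAt (fun s ↦ (α s).1) 1 t :=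
    (hα t ht).fst
  have hα2 (t : ℝ) (ht : t ∈ Set.Ioo (0 - ε) (0 + ε)) :
      HasDerivAt (fun s ↦ (α s).2) (A (α t).1 (α t).2) t := (hα t ht).snd
  refine ⟨fun t ↦ (α t).2, by simp only [hα0], ε, hε, fun t ht ↦ ?_⟩
  have hsub : ∀ s ∈ Set.Icc 0 t, s ∈ Set.Ioo (0 - ε) (0 + ε) := fun s hs ↦
    ⟨by linarith [hs.1], by linarith [hs.2, ht.2]⟩
  have hconst := constant_of_has_deriv_right_zero (f := fun s ↦ (α s).1 - s) (a := 0) (b := t)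
    (fun s hs ↦ ((hα1 s (hsub s hs)).continuousAt.sub continuousAt_id).continuousWithinAt)
    (fun s hs ↦ by
      simpa using ((hα1 s (hsub s ⟨hs.1, hs.2.le⟩)).fun_sub (hasDerivAt_id' s)).hasDerivWithinAt)
    t ⟨ht.1, le_rfl⟩
  have ht' : (α t).1 = t := by
    have : (α 0).1 = 0 := by rw [hα0]
    simp only [this] at hconst
    linarith
  have := hα2 t (hsub t ⟨ht.1, le_rfl⟩)
  rwa [ht'] at this

/-- Parallel transport along the straight lines of a chart exists for a short time. -/
lemma exists_isParallelAlong_chartCurve [T2Space M] {D : Connection E M}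
    (hD : CovariantDerivative.ContMDiffCovariantDerivative D ∞) (x : M) (u w₀ : E) :
    ∃ w : ℝ → E, w 0 = w₀ ∧ ∃ ε > 0,
      (∀ t ∈ Set.Icc 0 ε, extChartAt 𝓘(ℝ, E) x x + t • u ∈ (extChartAt 𝓘(ℝ, E) x).target) ∧
      ∀ c : ℝ, ∀ b ∈ Set.Ioc 0 ε, IsParallelAlong D (chartCurve x u) 0 b
        (fun t ↦ frameField x (c • w t) (chartCurve x u t)) := by
  have hA : ContDiffAt ℝ 1 (fun t ↦ -christoffelCLM D x u (chartCurve x u t)) 0 := by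
    have h1 := contMDiffAt_christoffelCLM hD x u
    have h2 := contMDiffAt_chartCurve (x := x) (u := u) (t := 0) (by simp)
    have h3 : ContMDiffAt 𝓘(ℝ, ℝ) 𝓘(ℝ, E →L[ℝ] E) ∞
        (christoffelCLM D x u ∘ chartCurve x u) 0 :=
      ContMDiffAt.comp 0 (by rwa [chartCurve_zero]) h2
    exact (h3.contDiffAt.of_le (by exact_mod_cast le_top)).neg
  obtain ⟨w, hw0, ε, hε, hw⟩ := exists_hasDerivAt_linear hA w₀
  obtain ⟨δ, hδ, hδt⟩ := Metric.eventually_nhds_iff.mp (eventually_mem_target x u)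
  have htar : ∀ t ∈ Set.Icc 0 (min ε δ / 2),
      extChartAt 𝓘(ℝ, E) x x + t • u ∈ (extChartAt 𝓘(ℝ, E) x).target := by
    intro t ht
    refine hδt ?_
    rw [dist_zero_right, Real.norm_eq_abs, abs_of_nonneg ht.1]
    linarith [ht.2, min_le_right ε δ, lt_min hε hδ]
  -- Halving keeps the closed interval inside both open ranges. By linearity `c • w` solves the same
  -- equation, so c = 1 and c = -1 will give V and -V; arbitrary endpoints `b` will give constancy
  -- at every time.
  refine ⟨w, hw0, min ε δ / 2, by positivity, htar, fun c b hb t ht ↦ ⟨x, ?_⟩⟩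
  have htε : t ∈ Set.Icc 0 (min ε δ / 2) := ⟨ht.1, ht.2.trans hb.2⟩
  have hmem (s : ℝ) (hs : s ∈ Set.Icc 0 b) : chartCurve x u s ∈ frameSet E x :=
    chartCurve_mem_frameSet (htar s ⟨hs.1, hs.2.trans hb.2⟩)
  refine ⟨hmem t ht, ?_⟩
  have hd : mfderivWithin 𝓘(ℝ, ℝ) 𝓘(ℝ, E) (chartCurve x u) (Set.Icc 0 b) t (1 : ℝ) =
      frameField x u (chartCurve x u t) := by
    rw [mfderivWithin_eq_mfderiv (uniqueDiffOn_Icc hb.1 t ht).uniqueMDiffWithinAt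
      ((contMDiffAt_chartCurve (htar t htε)).mdifferentiableAt (by simp)),
      mfderiv_chartCurve (htar t htε)]
  have hcoord (s : ℝ) (hs : s ∈ Set.Icc 0 b) :
      coords x (frameField x (c • w s) (chartCurve x u s)) = c • w s :=
    coords_frameField (hmem s hs) _
  have hwt := ((hw t ⟨ht.1, by
    linarith [htε.2, min_le_left ε δ, lt_min hε hδ]⟩).const_smul c).hasDerivWithinAt
    (s := Set.Icc 0 b)
  have key : HasDerivWithinAt
      (fun s ↦ coords x (frameField x (c • w s) (chartCurve x u s)))
      (-coords x (D (frameField x (coords x (frameField x (c • w t) (chartCurve x u t))))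
        (chartCurve x u t) (mfderivWithin 𝓘(ℝ, ℝ) 𝓘(ℝ, E) (chartCurve x u) (Set.Icc 0 b) t
          (1 : ℝ)))) (Set.Icc 0 b) t := by
    rw [hd, hcoord t ht]
    change HasDerivWithinAt _ (-christoffel D x u (chartCurve x u t) (c • w t)) _ _
    rw [← christoffelCLM_apply D (hmem t ht), map_smul]
    refine (hwt.congr hcoord (hcoord t ht)).congr_deriv ?_
    rw [_root_.neg_apply, smul_neg]
  exact key

end ParallelTransport

/-! ### Compatible means metric with β♯ parallel. -/

section Compatible

variable {E : Type*} [NormedAddCommGroup E] [NormedSpace ℝ E] [FiniteDimensional ℝ E]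
  {M : Type*} [TopologicalSpace M] [T2Space M] [ChartedSpace E M] [IsManifold 𝓘(ℝ, E) ∞ M]
  [RiemannianBundle (fun x : M ↦ TangentSpace 𝓘(ℝ, E) x)]
  [IsContMDiffRiemannianBundle 𝓘(ℝ, E) ∞ E (fun x : M ↦ TangentSpace 𝓘(ℝ, E) x)]
  {β : Π x : M, TangentSpace 𝓘(ℝ, E) x →L[ℝ] ℝ} {D : Connection E M}

/-- A metric connection for which `β♯` is parallel is compatible with the Randers metric. -/
lemma isCompatible_of_isMetric (hβ : IsSmoothOneForm β)
    (hD : CovariantDerivative.ContMDiffCovariantDerivative D ∞) (hm : IsMetric D)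
    (hB : ∀ x, D (sharp β) x = 0) : IsCompatible β D := by
  refine ⟨hD, fun γ a b hab hγ V hV ↦ ?_⟩
  -- Derivatives within `Icc a b` are unique only on a nondegenerate interval.
  rcases hab.eq_or_lt with rfl | hab
  · rfl
  have hγ' : MDifferentiableOn 𝓘(ℝ, ℝ) 𝓘(ℝ, E) γ (Set.Icc a b) :=
    hγ.mdifferentiableOn (by simp)
  have hm' := isMetric_iff.mp hm
  have h1 (t : ℝ) (ht : t ∈ Set.Icc a b) :
      HasDerivWithinAt (fun r ↦ (inner ℝ (V r) (V r) : ℝ)) 0 (Set.Icc a b) t :=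
    (hV.hasDerivWithinAt_inner_self hab hγ' ht).congr_deriv (hm' _ _ _ _)
  have h2 (t : ℝ) (ht : t ∈ Set.Icc a b) :
      HasDerivWithinAt (fun r ↦ (inner ℝ (sharp β (γ r)) (V r) : ℝ)) 0 (Set.Icc a b) t :=
    (hV.hasDerivWithinAt_inner hab hγ' ht
      (hβ.isSmoothField_sharp.smoothNear _).mdifferentiableAt).congr_deriv (by
        rw [hm', hB, _root_.zero_apply, inner_zero_left, add_zero])
  have hconst {f : ℝ → ℝ} (hf : ∀ t ∈ Set.Icc a b, HasDerivWithinAt f 0 (Set.Icc a b) t) :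
      f b = f a :=
    constant_of_derivWithin_zero (fun t ht ↦ (hf t ht).differentiableWithinAt)
      (fun t ht ↦ (hf t (Set.Ico_subset_Icc_self ht)).derivWithin
        (uniqueDiffOn_Icc hab t (Set.Ico_subset_Icc_self ht))) b (Set.right_mem_Icc.mpr hab.le)
  have e1 := hconst h1
  have e2 := hconst h2
  simp only [inner_sharp] at e1 e2
  rw [randersNorm, randersNorm, e1, e2]

/-- The sum and difference of F(V) and F(-V) show that α(V,V) and β(V) are both constant along a
short chart line; the two identities are their derivatives at time zero. -/
lemma IsCompatible.metricDefect_frameField (hβ : IsSmoothOneForm β) (h : IsCompatible β D) (x : M)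
    (u w₀ : E) :
    metricDefect D x (frameField x w₀ x) (frameField x w₀ x) (frameField x u x) = 0 ∧
    inner ℝ (D (sharp β) x (frameField x u x)) (frameField x w₀ x)
      + metricDefect D x (sharp β x) (frameField x w₀ x) (frameField x u x) = 0 := by
  obtain ⟨w, hw0, ε, hε, htar, hpar⟩ := exists_isParallelAlong_chartCurve h.smooth x u w₀
  set γ := chartCurve x u with hγdef
  let V (t : ℝ) : TangentSpace 𝓘(ℝ, E) (γ t) := frameField x ((1 : ℝ) • w t) (γ t)
  have hmem (t : ℝ) (ht : t ∈ Set.Icc 0 ε) : γ t ∈ frameSet E x :=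
    chartCurve_mem_frameSet (htar t ht)
  have hsm (b : ℝ) (hb : b ∈ Set.Ioc 0 ε) : ContMDiffOn 𝓘(ℝ, ℝ) 𝓘(ℝ, E) ∞ γ (Set.Icc 0 b) :=
    fun t ht ↦ (contMDiffAt_chartCurve (htar t ⟨ht.1, ht.2.trans hb.2⟩)).contMDiffWithinAt
  have hε' : ε ∈ Set.Ioc 0 ε := ⟨hε, le_rfl⟩
  have h0 : (0 : ℝ) ∈ Set.Icc 0 ε := ⟨le_rfl, hε.le⟩
  have hconst (t : ℝ) (ht : t ∈ Set.Icc 0 ε) :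
      inner ℝ (V t) (V t) = inner ℝ (V 0) (V 0) ∧ β (γ t) (V t) = β (γ 0) (V 0) := by
    rcases ht.1.eq_or_lt with rfl | ht0
    · exact ⟨rfl, rfl⟩
    have hneg (s : ℝ) (hs : s ∈ Set.Icc 0 ε) : frameField x ((-1 : ℝ) • w s) (γ s) = -V s := by
      simp only [V]
      rw [neg_smul, ← neg_one_smul ℝ ((1 : ℝ) • w s), frameField_smul (hmem s hs), neg_one_smul]
    have e1 := h.randersNorm_eq γ 0 t ht.1 (hsm t ⟨ht0, ht.2⟩) V (hpar 1 t ⟨ht0, ht.2⟩)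
    have e2 := h.randersNorm_eq γ 0 t ht.1 (hsm t ⟨ht0, ht.2⟩) _ (hpar (-1) t ⟨ht0, ht.2⟩)
    rw [hneg t ht, hneg 0 h0] at e2
    simp only [randersNorm, map_neg, inner_neg_neg] at e1 e2
    refine ⟨?_, by linarith⟩
    have e3 : √(inner ℝ (V t) (V t)) = √(inner ℝ (V 0) (V 0)) := by linarith
    exact (Real.sqrt_inj real_inner_self_nonneg real_inner_self_nonneg).mp e3
  have hd : mfderivWithin 𝓘(ℝ, ℝ) 𝓘(ℝ, E) γ (Set.Icc 0 ε) 0 (1 : ℝ) = frameField x u (γ 0) := by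
    rw [mfderivWithin_eq_mfderiv (uniqueDiffOn_Icc hε 0 h0).uniqueMDiffWithinAt
      ((contMDiffAt_chartCurve (htar 0 h0)).mdifferentiableAt (by simp)),
      mfderiv_chartCurve (htar 0 h0)]
  have hγm : MDifferentiableOn 𝓘(ℝ, ℝ) 𝓘(ℝ, E) γ (Set.Icc 0 ε) :=
    (hsm ε hε').mdifferentiableOn (by simp)
  -- One-sided derivatives at the endpoint 0 suffice, since they are unique there.
  have hzero {f : ℝ → ℝ} {f' : ℝ} (hf : HasDerivWithinAt f f' (Set.Icc 0 ε) 0)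
      (hc : ∀ t ∈ Set.Icc 0 ε, f t = f 0) : f' = 0 :=
    (uniqueDiffOn_Icc hε 0 h0).eq_deriv _ hf
      ((hasDerivWithinAt_const 0 _ (f 0)).congr hc rfl)
  have hV : IsParallelAlong D γ 0 ε V := hpar 1 ε hε'
  have k1 := hzero (hV.hasDerivWithinAt_inner_self hε hγm h0) fun t ht ↦ (hconst t ht).1
  have k2 := hzero (hV.hasDerivWithinAt_inner hε hγm h0
    (hβ.isSmoothField_sharp.smoothNear _).mdifferentiableAt) fun t ht ↦ by
      simpa only [inner_sharp] using (hconst t ht).2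
  rw [hd] at k1 k2
  simp only [V, one_smul, hw0] at k1 k2
  rw [hγdef, chartCurve_zero] at k1 k2
  exact ⟨k1, k2⟩

lemma IsCompatible.isMetric (hβ : IsSmoothOneForm β) (h : IsCompatible β D) : IsMetric D := by
  rw [isMetric_iff]
  intro x v w u
  refine metricDefect_eq_zero_of_diag (fun v ↦ ?_) v w
  have := (h.metricDefect_frameField hβ x (coords x u) (coords x v)).1
  rwa [frameField_coords (mem_frameSet (E := E) x), frameField_coords (mem_frameSet (E := E) x)]
    at this

/-- Once the connection is known to be metric, the second derivative identity reduces to α(∇_u β♯,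
v) = 0 for all u, v. -/
lemma IsCompatible.apply_sharp (hβ : IsSmoothOneForm β) (h : IsCompatible β D) (x : M) :
    D (sharp β) x = 0 := by
  ext u
  refine ext_inner_right ℝ fun v ↦ ?_
  have := (h.metricDefect_frameField hβ x (coords x u) (coords x v)).2
  rw [frameField_coords (mem_frameSet (E := E) x), frameField_coords (mem_frameSet (E := E) x),
    isMetric_iff.mp (h.isMetric hβ), add_zero] at this
  rw [this, _root_.zero_apply, inner_zero_left]

end Compatible

/-! ### Constancy of the length of β♯. -/

section ConstantLength

variable {E : Type*} [NormedAddCommGroup E] [NormedSpace ℝ E] [FiniteDimensional ℝ E]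
  {M : Type*} [TopologicalSpace M] [T2Space M] [ChartedSpace E M] [IsManifold 𝓘(ℝ, E) ∞ M]

omit [FiniteDimensional ℝ E] [T2Space M] in
/-- A smooth function on a connected manifold whose differential vanishes is constant. -/
lemma eq_of_mvfderiv_eq_zero [ConnectedSpace M] {f : M → ℝ} (hf : MDiff f)
    (h : ∀ x, mvfderiv 𝓘(ℝ, E) f x = 0) (x y : M) : f x = f y := by
  refine IsLocallyConstant.apply_eq_of_isPreconnected (f := f) (s := Set.univ) ?_
    isPreconnected_univ trivial trivial
  rw [IsLocallyConstant.iff_eventually_eq]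
  intro x
  set φ := extChartAt 𝓘(ℝ, E) x
  obtain ⟨r, hr, hball⟩ := Metric.isOpen_iff.mp (isOpen_extChartAt_target (I := 𝓘(ℝ, E)) x) (φ x)
    (mem_extChartAt_target x)
  have hder (z : E) (hz : z ∈ Metric.ball (φ x) r) :
      HasFDerivAt (f ∘ φ.symm) (0 : E →L[ℝ] ℝ) z := by
    have h1 := (contMDiffOn_extChartAt_symm (I := 𝓘(ℝ, E)) (n := ∞) x).contMDiffAt
      ((isOpen_extChartAt_target x).mem_nhds (hball hz)) |>.mdifferentiableAt (by simp)
    have h2 := (hf (φ.symm z)).hasMFDerivAt.comp z h1.hasMFDerivAt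
    have h3 : mfderiv 𝓘(ℝ, E) 𝓘(ℝ, ℝ) f (φ.symm z) = 0 := h (φ.symm z)
    rw [h3, ContinuousLinearMap.zero_comp] at h2
    exact h2.hasFDerivAt
  -- A ball in the chart is convex, so the mean value theorem gives local constancy; connectedness
  -- does the rest.
  have hc (z : E) (hz : z ∈ Metric.ball (φ x) r) : f (φ.symm z) = f (φ.symm (φ x)) :=
    (convex_ball (φ x) r).is_const_of_fderivWithin_eq_zero (𝕜 := ℝ)
      (fun z hz ↦ (hder z hz).hasFDerivWithinAt.differentiableWithinAt)
      (fun z hz ↦ ((hder z hz).hasFDerivWithinAt).fderivWithin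
        (Metric.isOpen_ball.uniqueDiffWithinAt hz)) hz (Metric.mem_ball_self hr)
  filter_upwards [(continuousAt_extChartAt (I := 𝓘(ℝ, E)) x) (Metric.ball_mem_nhds _ hr),
    extChartAt_source_mem_nhds (I := 𝓘(ℝ, E)) x] with y hy hys
  have := hc (φ y) hy
  rwa [φ.left_inv hys, φ.left_inv (mem_extChartAt_source x)] at this

variable [RiemannianBundle (fun x : M ↦ TangentSpace 𝓘(ℝ, E) x)]
  [IsContMDiffRiemannianBundle 𝓘(ℝ, E) ∞ E (fun x : M ↦ TangentSpace 𝓘(ℝ, E) x)]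
  {β : Π x : M, TangentSpace 𝓘(ℝ, E) x →L[ℝ] ℝ} {D : Connection E M}

/-- The derivative of |β♯|² is 2α(∇β♯, β♯), which vanishes because β♯ is parallel for a metric
connection. -/
lemma norm_sharp_eq [ConnectedSpace M] (hβ : IsSmoothOneForm β) (h : IsCompatible β D) (x y : M) :
    ‖sharp β x‖ = ‖sharp β y‖ := by
  have hs (x : M) := (hβ.isSmoothField_sharp.smoothNear x).mdifferentiableAt
  have := eq_of_mvfderiv_eq_zero (E := E) (f := fun x ↦ (inner ℝ (sharp β x) (sharp β x) : ℝ))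
    (fun x ↦ mdifferentiableAt_inner (hs x) (hs x)) (fun x ↦ by
      ext u
      rw [(h.isMetric hβ).mvfderiv_inner (hs x) (hs x), h.apply_sharp hβ]
      simp) x y
  rw [real_inner_self_eq_norm_sq, real_inner_self_eq_norm_sq] at this
  exact (sq_eq_sq₀ (norm_nonneg _) (norm_nonneg _)).mp this

end ConstantLength

/-! ### The contorsion and the skew correction at a point. -/

section TensorConstructions

variable {V : Type*} [NormedAddCommGroup V] [InnerProductSpace ℝ V] [FiniteDimensional ℝ V]
  [CompleteSpace V]

/-- Minus the contorsion tensor: adding it to a metric connection with torsion `T` removes the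
torsion. -/
def contorsion (T : V →L[ℝ] V →L[ℝ] V) : V →L[ℝ] V →L[ℝ] V :=
  LinearMap.toContinuousBilinearMap <| LinearMap.mk₂ ℝ
    (fun Y X ↦ (-1 / 2 : ℝ) • (T X Y - ContinuousLinearMap.adjoint (T Y) X
      - ContinuousLinearMap.adjoint (T X) Y))
    (fun _ _ _ ↦ by simp only [map_add, _root_.add_apply]; module)
    (fun _ _ _ ↦ by
      simp only [map_smulₛₗ, _root_.smul_apply, conj_trivial, RingHom.id_apply]; module)
    (fun _ _ _ ↦ by simp only [map_add, _root_.add_apply]; module)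
    (fun _ _ _ ↦ by
      simp only [map_smulₛₗ, _root_.smul_apply, conj_trivial, RingHom.id_apply]; module)

/-- The adjoints express the terms with X or Y in the last slot as inner products with Z. For
alternating T the result is skew in Y and Z. -/
lemma inner_contorsion (T : V →L[ℝ] V →L[ℝ] V) (X Y Z : V) :
    inner ℝ (contorsion T Y X) Z =
      (-1 / 2) * (inner ℝ (T X Y) Z - inner ℝ (T Y Z) X - inner ℝ (T X Z) Y) := by
  have h : contorsion T Y X = (-1 / 2 : ℝ) • (T X Y - ContinuousLinearMap.adjoint (T Y) X
      - ContinuousLinearMap.adjoint (T X) Y) := rfl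
  rw [h, inner_smul_left, inner_sub_left, inner_sub_left, ContinuousLinearMap.adjoint_inner_left,
    ContinuousLinearMap.adjoint_inner_left, real_inner_comm X, real_inner_comm Y]
  rfl

/-- The orthogonal projection to the complement of a vector `B` of length `K`. -/
def projPerp (B : V) (K : ℝ) : V →L[ℝ] V :=
  ContinuousLinearMap.id ℝ V - (innerSL ℝ B).smulRight ((K ^ 2)⁻¹ • B)

omit [FiniteDimensional ℝ V] [CompleteSpace V] in
lemma projPerp_apply (B : V) (K : ℝ) (Y : V) :
    projPerp B K Y = Y - (inner ℝ B Y / K ^ 2) • B := by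
  simp only [projPerp, _root_.sub_apply, ContinuousLinearMap.id_apply,
    ContinuousLinearMap.smulRight_apply, innerSL_apply_apply, smul_smul, div_eq_mul_inv]

omit [FiniteDimensional ℝ V] [CompleteSpace V] in
lemma inner_projPerp_left (B : V) (K : ℝ) (Y Z : V) :
    inner ℝ (projPerp B K Y) Z = inner ℝ Y (projPerp B K Z) := by
  rw [projPerp_apply, projPerp_apply, inner_sub_left, inner_sub_right, inner_smul_left,
    inner_smul_right, real_inner_comm B Y]
  simp only [conj_trivial]
  ring

/-- The tensor `A` with `⟨A Y X, Z⟩ = -⟨B, X⟩ (⟨L PY, PZ⟩ - ⟨L PZ, PY⟩) / (2 K²)`, where `P` is the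
projection to the complement of `B`. -/
def skewTensor (B : V) (K : ℝ) (L : V →L[ℝ] V) : V →L[ℝ] V →L[ℝ] V :=
  (ContinuousLinearMap.smulRightL ℝ V V (innerSL ℝ B)) ∘L
    ((-(2 * K ^ 2)⁻¹ : ℝ) • (projPerp B K ∘L (L - ContinuousLinearMap.adjoint L) ∘L projPerp B K))

omit [FiniteDimensional ℝ V] in
lemma inner_skewTensor (B : V) (K : ℝ) (L : V →L[ℝ] V) (X Y Z : V) :
    inner ℝ (skewTensor B K L Y X) Z = -(inner ℝ B X / (2 * K ^ 2)) *
      (inner ℝ (L (projPerp B K Y)) (projPerp B K Z)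
        - inner ℝ (L (projPerp B K Z)) (projPerp B K Y)) := by
  have h : skewTensor B K L Y X = (inner ℝ B X : ℝ) • ((-(2 * K ^ 2)⁻¹ : ℝ) •
      projPerp B K (L (projPerp B K Y) - ContinuousLinearMap.adjoint L (projPerp B K Y))) := rfl
  rw [h, inner_smul_left, inner_smul_left, inner_projPerp_left, inner_sub_left,
    ContinuousLinearMap.adjoint_inner_left, real_inner_comm (L (projPerp B K Z))]
  simp only [conj_trivial]
  ring

end TensorConstructions

/-! ### How torsion depends on the connection. -/

section Connections

variable {E : Type*} [NormedAddCommGroup E] [NormedSpace ℝ E] [FiniteDimensional ℝ E]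
  {M : Type*} [TopologicalSpace M] [T2Space M] [ChartedSpace E M] [IsManifold 𝓘(ℝ, E) ∞ M]

lemma torsion_addOneForm (D : Connection E M)
    (A : Π x : M, TangentSpace 𝓘(ℝ, E) x →L[ℝ] TangentSpace 𝓘(ℝ, E) x →L[ℝ] TangentSpace 𝓘(ℝ, E) x)
    (x : M) (X Y : TangentSpace 𝓘(ℝ, E) x) :
    (CovariantDerivative.addOneForm D A).torsion x X Y = D.torsion x X Y + (A x Y X - A x X Y) := by
  obtain ⟨X, hX, rfl⟩ := exists_smoothField_eq X
  obtain ⟨Y, hY, rfl⟩ := exists_smoothField_eq Y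
  have hX' := (hX.smoothNear x).mdifferentiableAt
  have hY' := (hY.smoothNear x).mdifferentiableAt
  rw [CovariantDerivative.torsion_apply _ hX' hY', CovariantDerivative.torsion_apply _ hX' hY']
  simp only [CovariantDerivative.addOneForm, _root_.add_apply]
  abel

/-- Torsion is tensorial, hence determined by smooth fields, the only ones on which extremal
connections are shown to agree. -/
lemma Connection.torsion_congr {D D' : Connection E M}
    (h : ∀ Y, IsSmoothField Y → D Y = D' Y) (x : M) : D.torsion x = D'.torsion x := by
  ext X Y
  obtain ⟨X, hX, rfl⟩ := exists_smoothField_eq X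
  obtain ⟨Y, hY, rfl⟩ := exists_smoothField_eq Y
  have hX' := (hX.smoothNear x).mdifferentiableAt
  have hY' := (hY.smoothNear x).mdifferentiableAt
  rw [CovariantDerivative.torsion_apply _ hX' hY', CovariantDerivative.torsion_apply _ hX' hY',
    h X hX, h Y hY]

lemma smoothNear_torsion {D : Connection E M}
    (hD : CovariantDerivative.ContMDiffCovariantDerivative D ∞)
    {X Y : Π x : M, TangentSpace 𝓘(ℝ, E) x} {x : M} (hX : SmoothNear X x) (hY : SmoothNear Y x) :
    SmoothNear (fun y ↦ D.torsion y (X y) (Y y)) x := by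
  filter_upwards [Connection.smoothNear hD hY hX, Connection.smoothNear hD hX hY,
    hX.eventually, hY.eventually] with y h1 h2 hXy hYy
  have : IsManifold 𝓘(ℝ, E) (minSmoothness ℝ 2) M := by
    rw [minSmoothness_of_isRCLikeNormedField]
    infer_instance
  -- The bracket costs one derivative, harmless since ∞ + 1 = ∞.
  have : IsManifold 𝓘(ℝ, E) (((⊤ : ℕ∞) : ℕ∞ω) + 1) M :=
    inferInstanceAs (IsManifold 𝓘(ℝ, E) ∞ M)
  have h3 : CMDiffAt ∞ (T% (VectorField.mlieBracket 𝓘(ℝ, E) X Y)) y :=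
    ContMDiffAt.mlieBracket_vectorField (m := ⊤) (n := ⊤) hXy.contMDiffAt hYy.contMDiffAt (by simp)
  refine ((h1.sub_section h2).sub_section h3).congr_of_eventuallyEq ?_
  filter_upwards [hXy, hYy] with z hXz hYz
  have := D.torsion_apply (hXz.mdifferentiableAt (by simp)) (hYz.mdifferentiableAt (by simp))
  exact congrArg (TotalSpace.mk' E z) this

end Connections

/-! ### Perturbing connections by tensors; existence of the Lévi-Civita connection. -/

section RiemannianConnections

variable {E : Type*} [NormedAddCommGroup E] [NormedSpace ℝ E] [FiniteDimensional ℝ E]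
  {M : Type*} [TopologicalSpace M] [T2Space M] [ChartedSpace E M] [IsManifold 𝓘(ℝ, E) ∞ M]
  [RiemannianBundle (fun x : M ↦ TangentSpace 𝓘(ℝ, E) x)]
  [IsContMDiffRiemannianBundle 𝓘(ℝ, E) ∞ E (fun x : M ↦ TangentSpace 𝓘(ℝ, E) x)]
  {D : Connection E M}
  {A : Π x : M, TangentSpace 𝓘(ℝ, E) x →L[ℝ] TangentSpace 𝓘(ℝ, E) x →L[ℝ] TangentSpace 𝓘(ℝ, E) x}

/-- Adding a smooth tensor to a smooth connection gives a smooth connection. -/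
lemma contMDiffCovariantDerivative_addOneForm
    (hD : CovariantDerivative.ContMDiffCovariantDerivative D ∞)
    (hA : ∀ (x : M) (X Y Z : Π x : M, TangentSpace 𝓘(ℝ, E) x), SmoothNear X x → SmoothNear Y x →
      SmoothNear Z x → CMDiffAt ∞ (fun y ↦ (inner ℝ (A y (Y y) (X y)) (Z y) : ℝ)) x) :
    CovariantDerivative.ContMDiffCovariantDerivative (CovariantDerivative.addOneForm D A) ∞ := by
  refine ⟨⟨fun {σ} hσ ↦ ?_⟩⟩
  have hσ' : IsSmoothField σ := by
    rw [IsSmoothField, ← contMDiffOn_univ]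
    exact hσ.of_le (by simp)
  intro x _
  refine ContMDiffAt.contMDiffWithinAt ?_
  refine contMDiffAt_hom_of_frameField fun a ↦ contMDiffAt_of_inner_frameField fun b ↦ ?_
  have ha := smoothNear_frameField (mem_frameSet (E := E) x) a
  have hb := smoothNear_frameField (mem_frameSet (E := E) x) b
  have h1 := contMDiffAt_inner
    (Connection.smoothNear hD (hσ'.smoothNear x) ha).contMDiffAt hb.contMDiffAt
  have h2 := hA x _ _ _ ha (hσ'.smoothNear x) hb
  refine (h1.add h2).congr_of_eventuallyEq (Eventually.of_forall fun y ↦ ?_)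
  exact inner_add_left _ _ _

omit [FiniteDimensional ℝ E] [T2Space M]
  [IsContMDiffRiemannianBundle 𝓘(ℝ, E) ∞ E (fun x : M ↦ TangentSpace 𝓘(ℝ, E) x)] in
lemma IsMetric.addOneForm (hD : IsMetric D)
    (hA : ∀ x X Y Z, inner ℝ (A x Y X) Z = -inner ℝ (A x Z X) Y) :
    IsMetric (CovariantDerivative.addOneForm D A) := by
  intro x v Y Z hY hZ
  rw [hD x v Y Z hY hZ]
  simp only [CovariantDerivative.addOneForm, _root_.add_apply, inner_add_left, inner_add_right]
  rw [hA, real_inner_comm (A x (Z x) v) (Y x)]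
  ring

/-- A smooth metric connection can be made torsion-free. -/
lemma exists_isLeviCivita (hD : CovariantDerivative.ContMDiffCovariantDerivative D ∞)
    (hm : IsMetric D) : ∃ D' : Connection E M, IsLeviCivita D' := by
  refine ⟨CovariantDerivative.addOneForm D fun x ↦ contorsion (D.torsion x), ?_, ?_, fun x ↦ ?_⟩
  · refine contMDiffCovariantDerivative_addOneForm hD fun x X Y Z hX hY hZ ↦ ?_
    simp only [inner_contorsion]
    have h {X Y Z : Π x : M, TangentSpace 𝓘(ℝ, E) x} (hX : SmoothNear X x) (hY : SmoothNear Y x)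
        (hZ : SmoothNear Z x) :
        CMDiffAt ∞ (fun y ↦ (inner ℝ (D.torsion y (X y) (Y y)) (Z y) : ℝ)) x :=
      contMDiffAt_inner (smoothNear_torsion hD hX hY).contMDiffAt hZ.contMDiffAt
    exact contMDiffAt_const.mul (((h hX hY hZ).sub (h hY hZ hX)).sub (h hX hZ hY))
  · refine hm.addOneForm fun x X Y Z ↦ ?_
    rw [inner_contorsion, inner_contorsion, D.torsion_antisymm Y Z, inner_neg_left]
    ring
  · ext X Y
    refine ext_inner_right ℝ fun Z ↦ ?_
    rw [torsion_addOneForm, inner_add_left, inner_sub_left, inner_contorsion, inner_contorsion,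
      D.torsion_antisymm Y X, _root_.zero_apply, _root_.zero_apply,
      inner_zero_left, inner_neg_left]
    ring

end RiemannianConnections

/-! ### The extremal connection: compatibility, minimality, uniqueness, torsion. -/

section Extremal

variable {E : Type*} [NormedAddCommGroup E] [NormedSpace ℝ E] [FiniteDimensional ℝ E]
  {M : Type*} [TopologicalSpace M] [T2Space M] [ChartedSpace E M] [IsManifold 𝓘(ℝ, E) ∞ M]
  [RiemannianBundle (fun x : M ↦ TangentSpace 𝓘(ℝ, E) x)]
  [IsContMDiffRiemannianBundle 𝓘(ℝ, E) ∞ E (fun x : M ↦ TangentSpace 𝓘(ℝ, E) x)]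
  {β : Π x : M, TangentSpace 𝓘(ℝ, E) x →L[ℝ] ℝ} {K : ℝ} {D : Connection E M}

/-- The compatible connection whose torsion has minimal norm, in terms of the Lévi-Civita
connection `D`. -/
def extremalConnection (D : Connection E M) (β : Π x : M, TangentSpace 𝓘(ℝ, E) x →L[ℝ] ℝ) (K : ℝ) :
    Connection E M :=
  CovariantDerivative.addOneForm (circConnection D β K) fun x ↦
    skewTensor (sharp β x) K (D (sharp β) x)

/-- Differentiate the constant |β♯|². -/
lemma inner_apply_sharp_sharp (hβ : IsSmoothOneForm β) (hK : ∀ x, ‖sharp β x‖ = K)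
    (hD : IsMetric D) (x : M) (u : TangentSpace 𝓘(ℝ, E) x) :
    inner ℝ (D (sharp β) x u) (sharp β x) = 0 := by
  have hs := (hβ.isSmoothField_sharp.smoothNear x).mdifferentiableAt
  have h := hD.mvfderiv_inner hs hs u
  simp only [real_inner_self_eq_norm_sq, hK, mvfderiv_const, _root_.zero_apply] at h
  rw [real_inner_comm (D (sharp β) x u)] at h
  linarith [real_inner_comm (D (sharp β) x u) (sharp β x)]

/-- The exterior derivative of `β` in terms of the Lévi-Civita connection. -/
lemma extDerivOneForm_eq (hβ : IsSmoothOneForm β) (hD : IsLeviCivita D)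
    {X Y : Π x : M, TangentSpace 𝓘(ℝ, E) x} (hX : IsSmoothField X) (hY : IsSmoothField Y) (x : M) :
    extDerivOneForm β X Y x =
      inner ℝ (D (sharp β) x (X x)) (Y x) - inner ℝ (D (sharp β) x (Y x)) (X x) := by
  have hs := (hβ.isSmoothField_sharp.smoothNear x).mdifferentiableAt
  have hX' := (hX.smoothNear x).mdifferentiableAt
  have hY' := (hY.smoothNear x).mdifferentiableAt
  have ht := D.torsion_apply hX' hY'
  rw [hD.torsion_free, _root_.zero_apply, _root_.zero_apply] at ht
  simp only [extDerivOneForm, ← inner_sharp β]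
  rw [hD.metric.mvfderiv_inner hs hY', hD.metric.mvfderiv_inner hs hX',
    ← sub_eq_zero.mp ht.symm, inner_sub_right]
  ring

/-- Both added tensors are skew, so the connection stays metric. The first cancels ∇*β♯ and the
second kills β♯ through its projections. -/
lemma isCompatible_extremalConnection (hβ : IsSmoothOneForm β) (hK0 : 0 < K)
    (hK : ∀ x, ‖sharp β x‖ = K) (hD : IsLeviCivita D) :
    IsCompatible β (extremalConnection D β K) := by
  have hsB (x : M) := hβ.isSmoothField_sharp.smoothNear x
  have hdd {X Y : Π x : M, TangentSpace 𝓘(ℝ, E) x} {x : M} (hX : SmoothNear X x)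
      (hY : SmoothNear Y x) :
      CMDiffAt ∞ (fun y ↦ (inner ℝ (D (sharp β) y (X y)) (Y y) : ℝ)) x :=
    contMDiffAt_inner (Connection.smoothNear hD.smooth (hsB x) hX).contMDiffAt hY.contMDiffAt
  have hin {X Y : Π x : M, TangentSpace 𝓘(ℝ, E) x} {x : M} (hX : SmoothNear X x)
      (hY : SmoothNear Y x) : CMDiffAt ∞ (fun y ↦ (inner ℝ (X y) (Y y) : ℝ)) x :=
    contMDiffAt_inner hX.contMDiffAt hY.contMDiffAt
  have hproj {X : Π x : M, TangentSpace 𝓘(ℝ, E) x} {x : M} (hX : SmoothNear X x) :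
      SmoothNear (fun y ↦ projPerp (sharp β y) K (X y)) x := by
    filter_upwards [hX.eventually] with y hy
    have h : CMDiffAt ∞ (fun y ↦ (inner ℝ (sharp β y) (X y) / K ^ 2 : ℝ)) y := by
      simp only [div_eq_mul_inv]
      exact (hin (hsB y) hy).mul contMDiffAt_const
    simp only [projPerp_apply]
    exact hy.contMDiffAt.sub_section (h.smul_section (hsB y).contMDiffAt)
  refine isCompatible_of_isMetric hβ ?_ ?_ fun x ↦ ?_
  · refine contMDiffCovariantDerivative_addOneForm
      (contMDiffCovariantDerivative_addOneForm hD.smooth ?_) ?_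
    · intro x X Y Z hX hY hZ
      simp only [diffTensor_apply, inner_sub_left, inner_smul_left, conj_trivial, div_eq_mul_inv]
      exact (((hdd hX hY).mul contMDiffAt_const).mul (hin (hsB x) hZ)).sub
        (((hin hY (hsB x)).mul contMDiffAt_const).mul (hdd hX hZ))
    · intro x X Y Z hX hY hZ
      simp only [inner_skewTensor, div_eq_mul_inv]
      exact ((hin (hsB x) hX).mul contMDiffAt_const).neg.mul
        ((hdd (hproj hY) (hproj hZ)).sub (hdd (hproj hZ) (hproj hY)))
  · refine (hD.metric.addOneForm fun x X Y Z ↦ ?_).addOneForm fun x X Y Z ↦ ?_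
    · simp only [diffTensor_apply, inner_sub_left, inner_smul_left, conj_trivial,
        real_inner_comm (sharp β x)]
      ring
    · simp only [inner_skewTensor]
      ring
  · ext u
    have hBB : inner ℝ (sharp β x) (sharp β x) = K ^ 2 := by
      rw [real_inner_self_eq_norm_sq, hK]
    have hK2 : K ^ 2 ≠ 0 := by positivity
    have hP : projPerp (sharp β x) K (sharp β x) = 0 := by
      rw [projPerp_apply, hBB, div_self hK2, one_smul, sub_self]
    have h1 : diffTensor D β K x (sharp β x) u = -D (sharp β) x u := by
      rw [diffTensor_apply, inner_apply_sharp_sharp hβ hK hD.metric, hBB, div_self hK2]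
      simp
    have h2 : skewTensor (sharp β x) K (D (sharp β) x) (sharp β x) u = 0 := by
      refine ext_inner_right ℝ fun Z ↦ ?_
      rw [inner_skewTensor, hP]
      simp
    change D (sharp β) x u + diffTensor D β K x (sharp β x) u
      + skewTensor (sharp β x) K (D (sharp β) x) (sharp β x) u = _
    rw [h1, h2]
    simp

omit [IsContMDiffRiemannianBundle 𝓘(ℝ, E) ∞ E (fun x : M ↦ TangentSpace 𝓘(ℝ, E) x)] in
lemma inner_torsion_circConnection (hD : IsLeviCivita D) (x : M) (X Y Z : TangentSpace 𝓘(ℝ, E) x) :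
    inner ℝ ((circConnection D β K).torsion x X Y) Z =
      inner ℝ (diffTensor D β K x Y X) Z - inner ℝ (diffTensor D β K x X Y) Z := by
  rw [circConnection, torsion_addOneForm, hD.torsion_free, _root_.zero_apply, _root_.zero_apply,
    zero_add, inner_sub_left]

omit [IsContMDiffRiemannianBundle 𝓘(ℝ, E) ∞ E (fun x : M ↦ TangentSpace 𝓘(ℝ, E) x)] in
lemma inner_torsion_extremalConnection (x : M) (X Y Z : TangentSpace 𝓘(ℝ, E) x) :
    inner ℝ ((extremalConnection D β K).torsion x X Y) Z =
      inner ℝ ((circConnection D β K).torsion x X Y) Z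
      + (inner ℝ (skewTensor (sharp β x) K (D (sharp β) x) Y X) Z
      - inner ℝ (skewTensor (sharp β x) K (D (sharp β) x) X Y) Z) := by
  rw [extremalConnection, torsion_addOneForm, inner_add_left, inner_sub_left]

omit [IsContMDiffRiemannianBundle 𝓘(ℝ, E) ∞ E (fun x : M ↦ TangentSpace 𝓘(ℝ, E) x)] in
/-- The torsion of the extremal connection is symmetric on the orthogonal complement of `β♯`. -/
lemma inner_torsion_extremalConnection_comm (hD : IsLeviCivita D) (x : M)
    (X Y Z : TangentSpace 𝓘(ℝ, E) x) (hY : inner ℝ Y (sharp β x) = 0)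
    (hZ : inner ℝ Z (sharp β x) = 0) :
    inner ℝ ((extremalConnection D β K).torsion x X Y) Z =
      inner ℝ ((extremalConnection D β K).torsion x X Z) Y := by
  have hY' : inner ℝ (sharp β x) Y = 0 := by rwa [real_inner_comm]
  have hZ' : inner ℝ (sharp β x) Z = 0 := by rwa [real_inner_comm]
  have hPY : projPerp (sharp β x) K Y = Y := by simp [projPerp_apply, hY']
  have hPZ : projPerp (sharp β x) K Z = Z := by simp [projPerp_apply, hZ']
  -- For Y, Z ⊥ β♯ only β(X) α(∇*_Y β♯, Z)/K² survives from ∇°, and the correction removes exactly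
  -- its skew half.
  simp only [inner_torsion_extremalConnection, inner_torsion_circConnection hD, diffTensor_apply,
    inner_skewTensor, inner_sub_left, inner_smul_left, conj_trivial, hPY, hPZ, hY, hZ, hY', hZ',
    real_inner_comm (sharp β x) X]
  ring

/-- Comparison of a compatible connection with the extremal one. -/
lemma torsionNormSq_eq (hβ : IsSmoothOneForm β) (hK0 : 0 < K)
    (hK : ∀ x, ‖sharp β x‖ = K) (hD : IsLeviCivita D) {D' : Connection E M}
    (hD' : IsCompatible β D') (x : M) :
    torsionNormSq (extremalConnection D β K) x ≤ torsionNormSq D' x ∧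
    (torsionNormSq D' x ≤ torsionNormSq (extremalConnection D β K) x →
      ∀ Y, IsSmoothField Y → D' Y x = extremalConnection D β K Y x) := by
  set D₀ := extremalConnection D β K with hD₀def
  have hD₀ : IsCompatible β D₀ := isCompatible_extremalConnection hβ hK0 hK hD
  -- The difference tensor takes the differentiated field first and the direction second; `A.flip X`
  -- is the endomorphism A_X.
  set A := CovariantDerivative.difference D' D₀ x with hAdef
  have hA (Y : Π x : M, TangentSpace 𝓘(ℝ, E) x) (hY : IsSmoothField Y) :
      A (Y x) = D' Y x - D₀ Y x :=
    IsCovariantDerivativeOn.difference_apply _ _ (Set.mem_univ x)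
      (hY.smoothNear x).mdifferentiableAt
  have hB0 : sharp β x ≠ 0 := by
    rw [← norm_pos_iff, hK]
    exact hK0
  have hskew (X Y Z : TangentSpace 𝓘(ℝ, E) x) :
      inner ℝ (A.flip X Y) Z = -inner ℝ (A.flip X Z) Y := by
    obtain ⟨Y, hY, rfl⟩ := exists_smoothField_eq Y
    obtain ⟨Z, hZ, rfl⟩ := exists_smoothField_eq Z
    have h1 := hD'.isMetric hβ x X Y Z hY hZ
    have h2 := hD₀.isMetric hβ x X Y Z hY hZ
    rw [ContinuousLinearMap.flip_apply, ContinuousLinearMap.flip_apply, hA Y hY, hA Z hZ,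
      _root_.sub_apply, _root_.sub_apply, inner_sub_left, inner_sub_left,
      real_inner_comm (Y x) (D' Z x X), real_inner_comm (Y x) (D₀ Z x X)]
    linarith
  have hAB (X : TangentSpace 𝓘(ℝ, E) x) : A.flip X (sharp β x) = 0 := by
    rw [ContinuousLinearMap.flip_apply, hA _ hβ.isSmoothField_sharp, hD'.apply_sharp hβ,
      hD₀.apply_sharp hβ]
    simp
  have htor (X Y : TangentSpace 𝓘(ℝ, E) x) :
      D'.torsion x X Y = D₀.torsion x X Y + (A.flip X Y - A.flip Y X) := by
    obtain ⟨X, hX, rfl⟩ := exists_smoothField_eq X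
    obtain ⟨Y, hY, rfl⟩ := exists_smoothField_eq Y
    have hX' := (hX.smoothNear x).mdifferentiableAt
    have hY' := (hY.smoothNear x).mdifferentiableAt
    rw [CovariantDerivative.torsion_apply _ hX' hY', CovariantDerivative.torsion_apply _ hX' hY',
      ContinuousLinearMap.flip_apply, ContinuousLinearMap.flip_apply, hA Y hY, hA X hX,
      _root_.sub_apply, _root_.sub_apply]
    abel
  have hsum : torsionNormSq D' x = torsionNormSq D₀ x
      + bilinNormSq (stdOrthonormalBasis ℝ (TangentSpace 𝓘(ℝ, E) x)) (A.flip - A.flip.flip) :=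
    bilinNormSq_add _ hB0 (D₀.torsion x) (D'.torsion x) A.flip (D₀.torsion_antisymm)
      (inner_torsion_extremalConnection_comm hD x) hskew hAB htor
  have hnn := bilinNormSq_nonneg (stdOrthonormalBasis ℝ (TangentSpace 𝓘(ℝ, E) x))
    (A.flip - A.flip.flip)
  refine ⟨by linarith, fun hle Y hY ↦ ?_⟩
  -- Equality of norms kills the alternation of A, so A is symmetric as well as skew, hence zero.
  have h0 := eq_zero_of_bilinNormSq_eq_zero _ (le_antisymm (by linarith) hnn)
  have hA0 : A.flip = 0 := eq_zero_of_symm_of_skew (fun X Y ↦ by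
    have := congrArg (fun T ↦ T X Y) h0
    simpa [sub_eq_zero] using this) hskew
  have : A (Y x) = 0 := by
    ext X
    exact congrArg (fun T ↦ T X (Y x)) hA0
  rwa [hA Y hY, sub_eq_zero] at this

lemma isExtremal_extremalConnection (hβ : IsSmoothOneForm β) (hK0 : 0 < K)
    (hK : ∀ x, ‖sharp β x‖ = K) (hD : IsLeviCivita D) :
    IsExtremal β (extremalConnection D β K) :=
  ⟨isCompatible_extremalConnection hβ hK0 hK hD,
    fun _ hD' x ↦ (torsionNormSq_eq hβ hK0 hK hD hD' x).1⟩

lemma IsExtremal.eq_extremalConnection (hβ : IsSmoothOneForm β) (hK0 : 0 < K)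
    (hK : ∀ x, ‖sharp β x‖ = K) (hD : IsLeviCivita D) {D' : Connection E M}
    (hD' : IsExtremal β D') {Y : Π x : M, TangentSpace 𝓘(ℝ, E) x} (hY : IsSmoothField Y) :
    D' Y = extremalConnection D β K Y := by
  ext1 x
  exact (torsionNormSq_eq hβ hK0 hK hD hD'.compatible x).2
    (hD'.minimal _ (isCompatible_extremalConnection hβ hK0 hK hD) x) Y hY

/-- The torsion of the extremal connection. -/
lemma inner_torsion_extremalConnection_eq (hβ : IsSmoothOneForm β) (hK0 : 0 < K)
    (hK : ∀ x, ‖sharp β x‖ = K) (hD : IsLeviCivita D)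
    {X Y Z : Π x : M, TangentSpace 𝓘(ℝ, E) x} (hX : IsSmoothField X) (hY : IsSmoothField Y)
    (hZ : IsSmoothField Z) (x : M) :
    inner ℝ ((extremalConnection D β K).torsion x (X x) (Y x)) (Z x) =
      inner ℝ ((circConnection D β K).torsion x (X x) (Y x)) (Z x)
      + (β x (Y x) * extDerivOneForm β X Z x - β x (X x) * extDerivOneForm β Y Z x) / (2 * K ^ 2)
      + (β x (X x) * extDerivOneForm β Y (sharp β) x
          - β x (Y x) * extDerivOneForm β X (sharp β) x) / (2 * K ^ 4) * β x (Z x) := by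
  have hs := hβ.isSmoothField_sharp
  have hLB := inner_apply_sharp_sharp hβ hK hD.metric x
  rw [inner_torsion_extremalConnection, extDerivOneForm_eq hβ hD hX hZ,
    extDerivOneForm_eq hβ hD hY hZ, extDerivOneForm_eq hβ hD hY hs,
    extDerivOneForm_eq hβ hD hX hs]
  -- The K⁴ term comes from the β♯-components removed by the projections; `hLB` discards the terms
  -- α(∇*β♯, β♯).
  simp only [inner_skewTensor, projPerp_apply, map_sub, map_smul, inner_sub_left, inner_sub_right,
    inner_smul_left, inner_smul_right, conj_trivial, hLB, inner_sharp]
  field_simp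
  ring

end Extremal

end Randers

end

theorem mainTheorem4
    {E : Type*} [NormedAddCommGroup E] [NormedSpace ℝ E] [FiniteDimensional ℝ E]
    {M : Type*} [TopologicalSpace M] [T2Space M] [ConnectedSpace M]
    [ChartedSpace E M] [IsManifold 𝓘(ℝ, E) ∞ M]
    [RiemannianBundle (fun x : M ↦ TangentSpace 𝓘(ℝ, E) x)]
    [IsContMDiffRiemannianBundle 𝓘(ℝ, E) ∞ E (fun x : M ↦ TangentSpace 𝓘(ℝ, E) x)]
    (β : Π x : M, TangentSpace 𝓘(ℝ, E) x →L[ℝ] ℝ)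
    (hF : Randers.IsRanders β) (hβ : ∃ x, β x ≠ 0)
    (hB : Randers.IsGeneralizedBerwald β) :
    ∃ K : ℝ, 0 < K ∧ (∀ x, ‖Randers.sharp β x‖ = K) ∧
      (∃ Dstar : Randers.Connection E M, Randers.IsLeviCivita Dstar) ∧
      (∃ D : Randers.Connection E M, Randers.IsExtremal β D) ∧
      (∀ D D' : Randers.Connection E M, Randers.IsExtremal β D → Randers.IsExtremal β D' →
        ∀ Y, Randers.IsSmoothField Y → D Y = D' Y) ∧
      ∀ Dstar D : Randers.Connection E M, Randers.IsLeviCivita Dstar → Randers.IsExtremal β D →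
        ∀ X Y Z, Randers.IsSmoothField X → Randers.IsSmoothField Y → Randers.IsSmoothField Z →
        ∀ x : M,
          inner ℝ (D.torsion x (X x) (Y x)) (Z x) =
            inner ℝ ((Randers.circConnection Dstar β K).torsion x (X x) (Y x)) (Z x)
            + (β x (Y x) * Randers.extDerivOneForm β X Z x
                - β x (X x) * Randers.extDerivOneForm β Y Z x) / (2 * K ^ 2)
            + (β x (X x) * Randers.extDerivOneForm β Y (Randers.sharp β) x
                - β x (Y x) * Randers.extDerivOneForm β X (Randers.sharp β) x) / (2 * K ^ 4)
              * β x (Z x) := by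
  have hβ' : Randers.IsSmoothOneForm β := hF.smooth
  obtain ⟨x₀, hx₀⟩ := hβ
  obtain ⟨D₁, hD₁⟩ := hB
  have hK0 : 0 < ‖Randers.sharp β x₀‖ := by
    rw [norm_pos_iff]
    intro h
    refine hx₀ (ContinuousLinearMap.ext fun v ↦ ?_)
    rw [← Randers.inner_sharp, h, inner_zero_left, _root_.zero_apply]
  have hK (x : M) : ‖Randers.sharp β x‖ = ‖Randers.sharp β x₀‖ :=
    Randers.norm_sharp_eq hβ' hD₁ x x₀
  obtain ⟨Dstar, hDstar⟩ := Randers.exists_isLeviCivita hD₁.smooth (hD₁.isMetric hβ')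
  refine ⟨‖Randers.sharp β x₀‖, hK0, hK, ⟨Dstar, hDstar⟩,
    ⟨_, Randers.isExtremal_extremalConnection hβ' hK0 hK hDstar⟩, ?_, ?_⟩
  · intro D D' hD hD' Y hY
    rw [hD.eq_extremalConnection hβ' hK0 hK hDstar hY,
      hD'.eq_extremalConnection hβ' hK0 hK hDstar hY]
  · intro Dstar D hDstar hD X Y Z hX hY hZ x
    -- The explicit connection is built from the arbitrary `Dstar` given here, so the formula holds
    -- for every Lévi-Civita connection.
    rw [Randers.Connection.torsion_congr
      (fun Y hY ↦ hD.eq_extremalConnection hβ' hK0 hK hDstar hY) x]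
    exact Randers.inner_torsion_extremalConnection_eq hβ' hK0 hK hDstar hX hY hZ x
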